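/- Let $(\phi_j)_{j\ge1}$ be an orthonormal basis of $L_2(0,1)$ and let $w$ be the Wiener process. For $\varepsilon>0$ one observes $dY_\varepsilon(t)=S(t)\,dt+\varepsilon\,dw(t)$, $t\in(0,1)$, $S\in L_2(0,1)$. Put $\theta_j=\int_0^1S\phi_j\,dt$ and $y_{\varepsilon j}=\int_0^1\phi_j\,dY_\varepsilon=\theta_j+\varepsilon\xi_j$ with $\xi_j=\int_0^1\phi_j\,dw$. For real coefficients $\varkappa_{\varepsilon j}$ with $\rho_\varepsilon^2=\sum_{j\ge1}\varkappa_{\varepsilon j}^2<\infty$ let $$A_\varepsilon=\varepsilon^{-4}\sum_{j\ge1}\varkappa_{\varepsilon j}^4,\qquad T_\varepsilon=\varepsilon^{-2}\sum_{j\ge1}\varkappa_{\varepsilon j}^2y_{\varepsilon j}^2-\rho_\varepsilon^2,\qquad k_\varepsilon=\sup\Big\{k\ge 1:\sum_{1\le j<k}\varkappa_{\varepsilon j}^2\le\tfrac12\rho_\varepsilon^2\Big\},\qquad \varkappa_\varepsilon^2=\varkappa_{\varepsilon k_\varepsilon}^2 .$$ The tests considered are $L_\varepsilon=\mathbf 1\{A_\varepsilon^{-1/2}T_\varepsilon>x_\varepsilon\}$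 with arbitrary critical values $x_\varepsilon\in\mathbb R$; $\alpha(L_\varepsilon)=\mathbf E_0L_\varepsilon$ and $\beta(L_\varepsilon,S)=\mathbf E_S(1-L_\varepsilon)$ are their error probabilities. Write $a_\varepsilon\asymp b_\varepsilon$ if $a_\varepsilon/b_\varepsilon$ lies between two positive constants for all sufficiently small $\varepsilon>0$, and $[a]$ for the integer part of $a$. Assume: A1. For each $\varepsilon>0$ the sequence $(\varkappa_{\varepsilon j}^2)_{j\ge1}$ is nonincreasing. A2. There are constants $0<c<C$ with $c<A_\varepsilon<C$ for all $\varepsilon>0$. A3. There are $C>0$ and $\lambda>1$ with $\varkappa^2_{\varepsilon,[(1+\delta)k_\varepsilon]}<C(1+\delta)^{-\lambda}\varkappa_\varepsilon^2$ for all $\delta>0$ and $\varepsilon>0$. A4. $\varkappa_{\varepsilon1}^2\asymp\varkappa_\varepsilon^2$ as $\varepsilon\to0$, and for every $c>1$ there is $C>0$ with $\varkappa^2_{\varepsilon,[ck_\varepsilon]}\ge C\varkappa_\varepsilon^2$ for all $\varepsilon>0$. Let $0<r<1/2$, $0<2\omega<1-2r$ and $k_\varepsilon\asymp\varepsilon^{-4+8r+4\omega}$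 as $\varepsilon\to0$. A family of alternatives $S_\varepsilon\in L_2(0,1)$, $\varepsilon>0$, is called $\varepsilon^{-2\omega}$-LD consistent if for all tests $L_\varepsilon$ as above with $\varepsilon^{4\omega}\log\alpha(L_\varepsilon)\to0$ as $\varepsilon\to0$ there is $c>0$ with $|\log\beta(L_\varepsilon,S_\varepsilon)|\ge c\,\varepsilon^{-4\omega}$ for all small $\varepsilon$ (with $|\log 0|=\infty$). The same definition applies to sequences $S_{1\varepsilon_i}$ with $\varepsilon_i>0$, $\varepsilon_i\to0$ as $i\to\infty$; a family or sequence that is not consistent is called inconsistent. A consistent family $S_\varepsilon$ with $\|S_\varepsilon\|\asymp\varepsilon^{2r}$ is called purely $\varepsilon^{-2\omega}$-LD consistent if there is no inconsistent sequence $S_{1\varepsilon_i}$, $\varepsilon_i\to0$, such that $S_{1\varepsilon_i}$ is orthogonal to $S_{\varepsilon_i}-S_{1\varepsilon_i}$ and $\|S_{1\varepsilon_i}\|>c_1\varepsilon_i^{2r}$ for all $i$ with some constant $c_1>0$. **Theorem.** Let $S_\varepsilon\in L_2(0,1)$, $\varepsilon>0$, be a family with $\|S_\varepsilon\|\asymp\varepsilon^{2r}$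 as $\varepsilon\to0$, and let $\theta_{\varepsilon j}=\int_0^1S_\varepsilon\phi_j\,dt$. Then $S_\varepsilon$ is purely $\varepsilon^{-2\omega}$-LD consistent if and only if for every $\delta>0$ there are $C_1=C_1(\delta)>0$ and $\varepsilon_0=\varepsilon_0(\delta)>0$ such that $$\sum_{j>C_1k_\varepsilon}|\theta_{\varepsilon j}|^2\le\delta\,\varepsilon^{4r}\qquad\text{for all }0<\varepsilon<\varepsilon_0 .$$ -/

import Mathlib

open Filter Topology Asymptotics MeasureTheory ProbabilityTheory

noncomputable section

namespace SignalDetection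

/-- The real Hilbert space `L₂(0,1)`. -/
abbrev L2 : Type := Lp ℝ 2 (volume.restrict (Set.Ioo (0 : ℝ) 1))

/-- Gaussian white noise on `(0,1)` over the probability space `(Ω, P)`, given through its
stochastic integrals: `W f` stands for `∫₀¹ f dw`. It is a centred Gaussian process indexed by
`L₂(0,1)` whose covariance is the inner product. -/
structure IsWhiteNoise {Ω : Type*} [MeasurableSpace Ω] (P : Measure Ω) (W : L2 → Ω → ℝ) :
    Prop where
  isGaussianProcess : IsGaussianProcess W P
  mean_eq_zero : ∀ f, ∫ ω, W f ω ∂P = 0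
  covariance_eq : ∀ f g, cov[W f, W g; P] = inner ℝ f g

/-! ### The coefficients of the test statistics

`ϰ ε j` is the coefficient with index `j ≥ 1` at noise level `ε`; the value `ϰ ε 0` is never
used. -/

/-- `ρ_ε² = ∑_{j ≥ 1} ϰ_{εj}²`. -/
def rhoSq (ϰ : ℝ → ℕ → ℝ) (ε : ℝ) : ℝ := ∑' j : ℕ+, ϰ ε j ^ 2

/-- `A_ε = ε⁻⁴ ∑_{j ≥ 1} ϰ_{εj}⁴`. -/
def bigA (ϰ : ℝ → ℕ → ℝ) (ε : ℝ) : ℝ := (ε ^ 4)⁻¹ * ∑' j : ℕ+, ϰ ε j ^ 4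

/-- `k_ε = sup {k ≥ 1 : ∑_{1 ≤ j < k} ϰ_{εj}² ≤ ρ_ε² / 2}`. -/
def kIdx (ϰ : ℝ → ℕ → ℝ) (ε : ℝ) : ℕ :=
  sSup {k : ℕ | 1 ≤ k ∧ ∑ j ∈ Finset.Ico 1 k, ϰ ε j ^ 2 ≤ rhoSq ϰ ε / 2}

/-- `ϰ_ε² = ϰ_{ε k_ε}²`. -/
def kappaSq (ϰ : ℝ → ℕ → ℝ) (ε : ℝ) : ℝ := ϰ ε (kIdx ϰ ε) ^ 2

/-- A1: for each `ε > 0` the sequence `ϰ_{εj}²`, `j ≥ 1`, is decreasing (not necessarily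
strictly). -/
def A1 (ϰ : ℝ → ℕ → ℝ) : Prop :=
  ∀ ε > 0, AntitoneOn (fun j : ℕ => ϰ ε j ^ 2) (Set.Ici 1)

/-- A2: `C₁ < A_ε < C₂` for all `ε > 0`, with positive constants. -/
def A2 (ϰ : ℝ → ℕ → ℝ) : Prop :=
  ∃ C₁ > 0, ∃ C₂ > 0, ∀ ε > 0, C₁ < bigA ϰ ε ∧ bigA ϰ ε < C₂

/-- A3: there are `C₁` and `lam > 1` with
`ϰ²_{ε, [(1+δ) k_ε]} < C₁ (1+δ)^{-lam} ϰ_ε²` for all `δ > 0` and all `ε > 0`. -/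
def A3 (ϰ : ℝ → ℕ → ℝ) : Prop :=
  ∃ C₁ > 0, ∃ lam > (1 : ℝ), ∀ δ > (0 : ℝ), ∀ ε > 0,
    ϰ ε ⌊(1 + δ) * (kIdx ϰ ε : ℝ)⌋₊ ^ 2 < C₁ * (1 + δ) ^ (-lam) * kappaSq ϰ ε

/-- A4: `ϰ_{ε1}² ≍ ϰ_ε²` as `ε → 0`, and for each `c > 1` there is `C > 0` with
`ϰ²_{ε, [c k_ε]} ≥ C ϰ_ε²` for all `ε > 0`. -/
def A4 (ϰ : ℝ → ℕ → ℝ) : Prop :=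
  ((fun ε => ϰ ε 1 ^ 2) =Θ[𝓝[>] 0] fun ε => kappaSq ϰ ε) ∧
  ∀ c > (1 : ℝ), ∃ C > 0, ∀ ε > 0,
    C * kappaSq ϰ ε ≤ ϰ ε ⌊c * (kIdx ϰ ε : ℝ)⌋₊ ^ 2

/-! ### Observations, test statistics and tests -/

/-- The Fourier coefficient `θ_j = ∫₀¹ S φ_j dt`. -/
def fourier (φ : HilbertBasis ℕ+ ℝ L2) (S : L2) (j : ℕ+) : ℝ := inner ℝ (φ j) S

section Tests

variable {Ω : Type*} [MeasurableSpace Ω]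

/-- The observation `y_{εj} = ∫₀¹ φ_j dY_ε = θ_j + ε ξ_j`, where `dY_ε = S dt + ε dw` and
`ξ_j = ∫₀¹ φ_j dw`. -/
def obs (W : L2 → Ω → ℝ) (φ : HilbertBasis ℕ+ ℝ L2) (ε : ℝ) (S : L2) (j : ℕ+) (ω : Ω) : ℝ :=
  fourier φ S j + ε * W (φ j) ω

/-- The test statistic `T_ε(Y_ε) = ε⁻² ∑_j ϰ_{εj}² y_{εj}² - ρ_ε²` under the signal `S`. -/
def stat (W : L2 → Ω → ℝ) (φ : HilbertBasis ℕ+ ℝ L2) (ϰ : ℝ → ℕ → ℝ) (ε : ℝ) (S : L2)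
    (ω : Ω) : ℝ :=
  (ε ^ 2)⁻¹ * ∑' j : ℕ+, ϰ ε j ^ 2 * obs W φ ε S j ω ^ 2 - rhoSq ϰ ε

/-- The event that the test `L_ε = 1{A_ε^{-1/2} T_ε > x}` rejects, when the signal is `S`. -/
def rejects (W : L2 → Ω → ℝ) (φ : HilbertBasis ℕ+ ℝ L2) (ϰ : ℝ → ℕ → ℝ) (ε : ℝ) (S : L2)
    (x : ℝ) : Set Ω :=
  {ω | x < (bigA ϰ ε) ^ (-(1 / 2) : ℝ) * stat W φ ϰ ε S ω}

/-- Type I error probability `α(L_ε)` of the test with critical value `x`. -/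
def typeI (P : Measure Ω) (W : L2 → Ω → ℝ) (φ : HilbertBasis ℕ+ ℝ L2) (ϰ : ℝ → ℕ → ℝ)
    (ε x : ℝ) : ℝ :=
  P.real (rejects W φ ϰ ε 0 x)

/-- Type II error probability `β(L_ε, S)` of the test with critical value `x`. -/
def typeII (P : Measure Ω) (W : L2 → Ω → ℝ) (φ : HilbertBasis ℕ+ ℝ L2) (ϰ : ℝ → ℕ → ℝ)
    (ε : ℝ) (S : L2) (x : ℝ) : ℝ :=
  P.real (rejects W φ ϰ ε S x)ᶜ

/-- LD consistency at rate `R` of a collection of alternatives `S i`, observed at noise levels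
`e i`, along a filter `l`: for all tests (critical values `x i`) with `R⁻² log α → 0` one has
`R² = O(|log β|)`. Here `l = 𝓝[>] 0`, `e = id` is the case of a family indexed by `ε > 0`, and
`l = atTop` on `ℕ` that of a sequence. As `0 ≤ β ≤ 1`, the bound `c R² ≤ |log β|` is written
`β ≤ exp (-c R²)`, which also covers `β = 0`, `|log β| = ∞`. -/
def LDConsistent {ι : Type*} (P : Measure Ω) (W : L2 → Ω → ℝ) (φ : HilbertBasis ℕ+ ℝ L2)
    (ϰ : ℝ → ℕ → ℝ) (l : Filter ι) (e : ι → ℝ) (R : ι → ℝ) (S : ι → L2) : Prop :=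
  ∀ x : ι → ℝ,
    (∀ᶠ i in l, 0 < typeI P W φ ϰ (e i) (x i)) →
    Tendsto (fun i => (R i ^ 2)⁻¹ * Real.log (typeI P W φ ϰ (e i) (x i))) l (𝓝 0) →
    ∃ c > 0, ∀ᶠ i in l, typeII P W φ ϰ (e i) (S i) (x i) ≤ Real.exp (-(c * R i ^ 2))

/-- Pure `ε^{-2w}`-LD consistency of a family `S_ε` of order `ε^{2r}`: the family is
`ε^{-2w}`-LD consistent, and there is no inconsistent sequence of alternatives `S₁_{ε_i}`,
`ε_i → 0`, such that `S₁_{ε_i}` is orthogonal to `S_{ε_i} - S₁_{ε_i}` and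
`‖S₁_{ε_i}‖ > c₁ ε_i^{2r}` for some constant `c₁ > 0`. -/
def PurelyLDConsistent (P : Measure Ω) (W : L2 → Ω → ℝ) (φ : HilbertBasis ℕ+ ℝ L2)
    (ϰ : ℝ → ℕ → ℝ) (r w : ℝ) (S : ℝ → L2) : Prop :=
  LDConsistent P W φ ϰ (𝓝[>] (0 : ℝ)) (fun ε => ε) (fun ε => ε ^ (-2 * w)) S ∧
  ¬ ∃ (e : ℕ → ℝ) (S₁ : ℕ → L2),
      (∀ i, 0 < e i) ∧ Tendsto e atTop (𝓝 0) ∧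
      (∃ c₁ > 0, ∀ i, c₁ * e i ^ (2 * r) < ‖S₁ i‖) ∧
      (∀ i, inner ℝ (S₁ i) (S (e i) - S₁ i) = 0) ∧
      ¬ LDConsistent P W φ ϰ atTop e (fun i => e i ^ (-2 * w)) S₁

end Tests

end SignalDetection

end

/-! Under the signal `S` the statistic is a weighted noncentral chi-square sum with independent
terms. Its centre is the drift D = ε⁻² ∑ ϰ_j² θ_j², and its variance is of order ∑ ϰ_j⁴ = ε⁴ A_ε ≍
ε⁴ when `S = 0`. Write R = ε^{-2w}. Exponential moments at the tilt t ≍ R/ε² control deviations of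
order Rε² at the exponential scale R², so Rε² is the critical order of the drift. If D ≳ Rε², a test
with log α = o(R²) has critical value o(Rε²), and Chernoff's bound makes β exponentially small
(`ldConsistent_of_le_drift`). If D = o(Rε²), a critical value slightly above 2D has log α = o(R²),
by a Paley–Zygmund lower bound, while β stays away from 0 (`not_ldConsistent_of_drift_le`).

The weights link drift and energy. A1–A4 give k_ε ϰ_ε⁴ ≍ ε⁴, hence ϰ_ε² ≍ ε^{4-4r-2w}
(`kappaSq_bounds`), and ε⁻² ϰ_ε² ε^{4r} ≍ Rε². By A4, energy of order ε^{4r} in the coordinates up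
to C k_ε therefore produces a drift of critical order. By A3, such energy beyond C k_ε contributes
only a fraction of order C^{-lam} of it.

If the tails of S_ε are not negligible, the tails beyond (i+2) k_ε at suitable noise levels form an
inconsistent sequence of orthogonal parts (`exists_inconsistent_of_energy_gt`). Conversely, an
orthogonal part S₁ satisfies ‖S₁‖² = ⟨S₁, S⟩. When the tails of S are negligible, S₁ must thus have
low-coordinate energy of order ε^{4r} (`norm_sq_le_energy_add`), so it is consistent. -/

noncomputable section

namespace SignalDetection

/-! ### Moment generating function of a shifted square of a Gaussian variable -/

section Scalar

open Real

/-- Completing the square: the tilted density is a multiple of another Gaussian density, so its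
integral is read off from total mass one. -/
lemma gaussianPDFReal_mul_exp_sq {s : ℝ} (hs : s < 1 / 2) (a x : ℝ) :
    gaussianPDFReal 0 1 x * exp (s * ((a + x) ^ 2 - 1)) =
      ((√(1 - 2 * s))⁻¹ * exp (-s) * exp (s * a ^ 2 / (1 - 2 * s))) *
        gaussianPDFReal (2 * s * a / (1 - 2 * s)) (Real.toNNReal (1 / (1 - 2 * s))) x := by
  have h : 0 < 1 - 2 * s := by linarith
  have hne := h.ne'
  simp only [gaussianPDFReal]
  rw [Real.coe_toNNReal _ (by positivity)]
  have e1 : √(2 * π * (1 / (1 - 2 * s))) = √(2 * π) * (√(1 - 2 * s))⁻¹ := by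
    rw [Real.sqrt_mul (by positivity), one_div, Real.sqrt_inv]
  rw [e1]
  have hsq : √(1 - 2 * s) ≠ 0 := (Real.sqrt_pos.2 h).ne'
  have hpi : √(2 * π) ≠ 0 := by positivity
  have e2 : exp (-(x - 0) ^ 2 / (2 * ((1 : NNReal) : ℝ))) * exp (s * ((a + x) ^ 2 - 1)) =
      exp (-s) * exp (s * a ^ 2 / (1 - 2 * s)) *
        exp (-(x - 2 * s * a / (1 - 2 * s)) ^ 2 / (2 * (1 / (1 - 2 * s)))) := by
    rw [← exp_add, ← exp_add, ← exp_add]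
    congr 1
    push_cast
    field_simp
    ring
  calc _ = (√(2 * π))⁻¹ * (exp (-(x - 0) ^ 2 / (2 * ((1 : NNReal) : ℝ))) *
        exp (s * ((a + x) ^ 2 - 1))) := by simp; ring
    _ = _ := by
      rw [e2]
      field_simp

lemma integral_exp_sq_gaussianReal {s : ℝ} (hs : s < 1 / 2) (a : ℝ) :
    ∫ x, exp (s * ((a + x) ^ 2 - 1)) ∂gaussianReal 0 1 =
      (√(1 - 2 * s))⁻¹ * exp (-s) * exp (s * a ^ 2 / (1 - 2 * s)) := by
  have h : 0 < 1 - 2 * s := by linarith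
  rw [integral_gaussianReal_eq_integral_smul one_ne_zero]
  simp only [smul_eq_mul, gaussianPDFReal_mul_exp_sq hs]
  rw [integral_const_mul, integral_gaussianPDFReal_eq_one, mul_one]
  simpa using (by linarith : 2 * s < 1)

lemma inv_sqrt_eq_exp {y : ℝ} (hy : 0 < y) : (√y)⁻¹ = exp (-(log y / 2)) := by
  rw [exp_neg, exp_half, exp_log hy]

/-- The linear terms of -log(1-2s)/2 and -s cancel, leaving a quadratic bound. Both signs of s
matter: negative ones serve the lower tail. -/
lemma inv_sqrt_mul_exp_le {s : ℝ} (hs : |s| ≤ 1 / 4) :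
    (√(1 - 2 * s))⁻¹ * exp (-s) ≤ exp (4 * s ^ 2) := by
  obtain ⟨h1, h2⟩ := abs_le.1 hs
  have h : 0 < 1 - 2 * s := by linarith
  rw [inv_sqrt_eq_exp h, ← exp_add, exp_le_exp]
  have hl := Real.one_sub_inv_le_log_of_pos h
  have : 1 - (1 - 2 * s)⁻¹ ≥ -(2 * s) - 8 * s ^ 2 := by
    rw [ge_iff_le, le_sub_iff_add_le, ← le_sub_iff_add_le', inv_le_iff_one_le_mul₀ h]
    nlinarith [sq_nonneg s]
  linarith

lemma exp_sq_le_inv_sqrt_mul_exp {s : ℝ} (hs0 : 0 ≤ s) (hs : s ≤ 1 / 4) :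
    exp (s ^ 2) ≤ (√(1 - 2 * s))⁻¹ * exp (-s) := by
  have h : 0 < 1 - 2 * s := by linarith
  rw [inv_sqrt_eq_exp h, ← exp_add, exp_le_exp]
  have hl := Real.hasSum_pow_div_log_of_abs_lt_one (x := 2 * s)
    (by rw [abs_of_nonneg (by linarith)]; linarith)
  -- Two terms of the series give -log(1-2s) ≥ 2s + 2s².
  have := sum_le_hasSum (Finset.range 2) (fun i _ => by positivity) hl
  simp [Finset.sum_range_succ] at this
  nlinarith

end Scalar

/-! ### Weighted noncentral chi-square sums -/

section QuadForm

variable {Ω ι : Type*} {ξ : ι → Ω → ℝ}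

/-- The centred quadratic form `∑ q_i ((a_i + ξ_i)² - 1)` over a finite set of indices. -/
def partialQuad (q a : ι → ℝ) (ξ : ι → Ω → ℝ) (F : Finset ι) (ω : Ω) : ℝ :=
  ∑ i ∈ F, q i * ((a i + ξ i ω) ^ 2 - 1)

/-- The centred quadratic form `∑ q_i (a_i + ξ_i)² - ∑ q_i`. -/
def quadForm (q a : ι → ℝ) (ξ : ι → Ω → ℝ) (ω : Ω) : ℝ :=
  ∑' i, q i * (a i + ξ i ω) ^ 2 - ∑' i, q i

lemma tendsto_partialQuad {q a : ι → ℝ} (hqs : Summable q) {ω : Ω}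
    (h : Summable fun i => q i * (a i + ξ i ω) ^ 2) :
    Tendsto (fun F => partialQuad q a ξ F ω) atTop (𝓝 (quadForm q a ξ ω)) := by
  have := h.hasSum.sub hqs.hasSum
  refine Tendsto.congr (fun F => ?_) this
  exact Finset.sum_congr rfl fun i _ => by ring

variable [MeasurableSpace Ω] {P : Measure Ω}

lemma mgf_partialQuad (hind : iIndepFun ξ P) (hlaw : ∀ i, HasLaw (ξ i) (gaussianReal 0 1) P)
    (q a : ι → ℝ) (F : Finset ι) {t : ℝ} (ht : ∀ i, t * q i < 1 / 2) :
    mgf (partialQuad q a ξ F) P t = ∏ i ∈ F, ((√(1 - 2 * (t * q i)))⁻¹ * Real.exp (-(t * q i)) *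
      Real.exp (t * q i * a i ^ 2 / (1 - 2 * (t * q i)))) := by
  have hmeas : ∀ i, Measurable fun x : ℝ => q i * ((a i + x) ^ 2 - 1) := fun i => by fun_prop
  have e : partialQuad q a ξ F =
      ∑ i ∈ F, ((fun i (x : ℝ) => q i * ((a i + x) ^ 2 - 1)) i ∘ ξ i) := by
    ext ω; simp [partialQuad]
  rw [e, (hind.comp (fun i (x : ℝ) => q i * ((a i + x) ^ 2 - 1)) hmeas).mgf_sum₀
    (fun i => (hmeas i).comp_aemeasurable (hlaw i).aemeasurable)]
  refine Finset.prod_congr rfl fun i _ => ?_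
  rw [← integral_exp_sq_gaussianReal (ht i) (a i), mgf,
    ← (hlaw i).integral_comp (by fun_prop)]
  simp [mul_assoc]

/-- The product formula for the mgf needs no integrability and is positive, whereas a nonintegrable
exponential would have mgf `0` by default. -/
lemma integrable_exp_partialQuad (hind : iIndepFun ξ P)
    (hlaw : ∀ i, HasLaw (ξ i) (gaussianReal 0 1) P) (q a : ι → ℝ) (F : Finset ι) {t : ℝ}
    (ht : ∀ i, t * q i < 1 / 2) :
    Integrable (fun ω => Real.exp (t * partialQuad q a ξ F ω)) P := by
  by_contra hn
  have h := mgf_partialQuad hind hlaw q a F ht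
  rw [mgf, integral_undef hn] at h
  refine absurd h (Finset.prod_pos fun i _ => ?_).ne
  have : 0 < 1 - 2 * (t * q i) := by linarith [ht i]
  positivity

lemma mgf_partialQuad_le (hind : iIndepFun ξ P) (hlaw : ∀ i, HasLaw (ξ i) (gaussianReal 0 1) P)
    (q a : ι → ℝ) (F : Finset ι) {t : ℝ} (ht : ∀ i, |t * q i| ≤ 1 / 4) :
    mgf (partialQuad q a ξ F) P t ≤ Real.exp (4 * t ^ 2 * ∑ i ∈ F, q i ^ 2 +
      ∑ i ∈ F, t * q i * a i ^ 2 / (1 - 2 * (t * q i))) := by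
  rw [mgf_partialQuad hind hlaw q a F fun i => by linarith [abs_le.1 (ht i)], Finset.mul_sum,
    ← Finset.sum_add_distrib, Real.exp_sum]
  refine Finset.prod_le_prod (fun i _ => by positivity) fun i _ => ?_
  rw [Real.exp_add]
  gcongr
  calc _ ≤ _ := inv_sqrt_mul_exp_le (ht i)
    _ = _ := by rw [mul_pow]; ring_nf

lemma exp_le_mgf_partialQuad (hind : iIndepFun ξ P)
    (hlaw : ∀ i, HasLaw (ξ i) (gaussianReal 0 1) P) {q : ι → ℝ} (hq : ∀ i, 0 ≤ q i)
    (F : Finset ι) {t : ℝ} (ht0 : 0 ≤ t) (ht : ∀ i, t * q i ≤ 1 / 4) :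
    Real.exp (t ^ 2 * ∑ i ∈ F, q i ^ 2) ≤ mgf (partialQuad q 0 ξ F) P t := by
  rw [mgf_partialQuad hind hlaw q 0 F fun i => by linarith [ht i], Finset.mul_sum, Real.exp_sum]
  refine Finset.prod_le_prod (fun i _ => by positivity) fun i _ => ?_
  have := exp_sq_le_inv_sqrt_mul_exp (mul_nonneg ht0 (hq i)) (ht i)
  simpa [mul_pow] using this

/-- A Paley–Zygmund inequality for the exponential of a random variable. -/
lemma sq_mgf_le_measureReal [IsProbabilityMeasure P] {X : Ω → ℝ} {t : ℝ}
    (h1 : Integrable (fun ω => Real.exp (t * X ω)) P)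
    (h2 : Integrable (fun ω => Real.exp (2 * t * X ω)) P) :
    mgf X P t ^ 2 / (4 * mgf X P (2 * t)) ≤
      P.real {ω | mgf X P t / 2 < Real.exp (t * X ω)} := by
  set m := mgf X P t with hm
  set M := mgf X P (2 * t) with hM
  have hmpos : 0 < m := mgf_pos h1
  have hMpos : 0 < M := mgf_pos h2
  -- With y the exponential, y ≤ c y²/2 + 1/(2c) on the event and y ≤ m/2 off it. This c makes the
  -- quadratic term integrate to m/4.
  set c := m / (2 * M) with hc
  have hcpos : 0 < c := by positivity
  have hset : NullMeasurableSet {ω | m / 2 < Real.exp (t * X ω)} P :=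
    nullMeasurableSet_lt aemeasurable_const h1.aemeasurable
  have hind : Integrable ({ω | m / 2 < Real.exp (t * X ω)}.indicator fun _ => (1 : ℝ)) P :=
    (integrable_const (1 : ℝ)).indicator₀ hset
  have key : m ≤ m / 2 + (c / 2 * M + P.real {ω | m / 2 < Real.exp (t * X ω)} / (2 * c)) := by
    calc m = ∫ ω, Real.exp (t * X ω) ∂P := rfl
      _ ≤ ∫ ω, (m / 2 + (c / 2 * Real.exp (2 * t * X ω) +
          ({ω | m / 2 < Real.exp (t * X ω)}.indicator (fun _ => (1 : ℝ)) ω) / (2 * c))) ∂P := by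
        refine integral_mono h1 (by fun_prop) fun ω => ?_
        have e : Real.exp (2 * t * X ω) = Real.exp (t * X ω) ^ 2 := by
          rw [← Real.exp_nat_mul]; ring_nf
        simp only [e, Set.indicator, Set.mem_ofPred_eq]
        set y := Real.exp (t * X ω) with hy
        have hypos : 0 < y := Real.exp_pos _
        split_ifs with hlt
        · have : c / 2 * y ^ 2 + 1 / (2 * c) - y = (c * y - 1) ^ 2 / (2 * c) := by
            field_simp; ring
          have h0 : 0 ≤ (c * y - 1) ^ 2 / (2 * c) := by positivity
          linarith
        · have h0 : 0 ≤ c / 2 * y ^ 2 + 0 / (2 * c) := by positivity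
          linarith
      _ = _ := by
        rw [integral_add (by fun_prop) (by fun_prop), integral_add (by fun_prop) (by fun_prop),
          integral_const_mul,
          integral_div (2 * c) ({ω | m / 2 < Real.exp (t * X ω)}.indicator _),
          integral_indicator₀ hset]
        simp [hM, mgf]
  have e1 : c / 2 * M = m / 4 := by rw [hc]; field_simp; norm_num
  have e2 : P.real {ω | m / 2 < Real.exp (t * X ω)} / (2 * c) =
      P.real {ω | m / 2 < Real.exp (t * X ω)} * M / m := by rw [hc]; field_simp
  rw [e1, e2] at key
  have h3 : m / 4 ≤ P.real {ω | m / 2 < Real.exp (t * X ω)} * M / m := by linarith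
  rw [div_le_iff₀ (by positivity)]
  rw [le_div_iff₀ hmpos] at h3
  nlinarith

/-- Upper bounds on probabilities of open sets pass to almost sure limits. -/
lemma measureReal_le_of_ae_tendsto [IsProbabilityMeasure P] {T : ℕ → Ω → ℝ} {T' : Ω → ℝ}
    (hT : ∀ᵐ ω ∂P, Tendsto (fun n => T n ω) atTop (𝓝 (T' ω))) {U : Set ℝ} (hU : IsOpen U)
    {p : ℝ} (hp : ∀ᶠ n in atTop, P.real {ω | T n ω ∈ U} ≤ p) :
    P.real {ω | T' ω ∈ U} ≤ p := by
  obtain ⟨N₀, hN₀⟩ := eventually_atTop.1 hp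
  have hp0 : 0 ≤ p := measureReal_nonneg.trans (hN₀ N₀ le_rfl)
  -- Since U is open, a limit in U forces the sequence into U eventually; continuity from below then
  -- finishes without any measurability.
  have hmono : Monotone fun N : ℕ => {ω | ∀ n ≥ N, T n ω ∈ U} := fun a b hab ω h n hn =>
    h n (hab.trans hn)
  have hsub : {ω | T' ω ∈ U} ≤ᵐ[P] ⋃ N : ℕ, {ω | ∀ n ≥ N, T n ω ∈ U} := by
    filter_upwards [hT] with ω hω hmem
    obtain ⟨N, hN⟩ := eventually_atTop.1 (hω.eventually (hU.mem_nhds hmem))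
    exact Set.mem_iUnion.2 ⟨N, hN⟩
  rw [measureReal_def]
  refine ENNReal.toReal_le_of_le_ofReal hp0 ((measure_mono_ae hsub).trans ?_)
  rw [hmono.measure_iUnion]
  refine iSup_le fun N => ?_
  calc P {ω | ∀ n ≥ N, T n ω ∈ U} ≤ P {ω | T (max N N₀) ω ∈ U} :=
        measure_mono fun ω h => h _ (le_max_left _ _)
    _ = ENNReal.ofReal (P.real {ω | T (max N N₀) ω ∈ U}) := by simp
    _ ≤ ENNReal.ofReal p := ENNReal.ofReal_le_ofReal (hN₀ _ (le_max_right _ _))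

/-- The sum ∑ q_i ξ_i² has finite expectation, and (a+ξ)² ≤ 2a² + 2ξ². This keeps the `tsum` in
`quadForm` from taking its default value, almost surely. -/
lemma ae_summable_quad [Countable ι] (hlaw : ∀ i, HasLaw (ξ i) (gaussianReal 0 1) P)
    {q a : ι → ℝ} (hq : ∀ i, 0 ≤ q i) (hqs : Summable q) (hqa : Summable fun i => q i * a i ^ 2) :
    ∀ᵐ ω ∂P, Summable fun i => q i * (a i + ξ i ω) ^ 2 := by
  have hξ2 : ∀ i, ∫⁻ ω, ENNReal.ofReal (ξ i ω ^ 2) ∂P ≤ 1 := fun i => by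
    have hi : Integrable (fun x : ℝ => x ^ 2) (gaussianReal 0 1) :=
      (memLp_id_gaussianReal 2).integrable_sq
    have h1 : ∫⁻ ω, ENNReal.ofReal (ξ i ω ^ 2) ∂P =
        ∫⁻ x, ENNReal.ofReal (x ^ 2) ∂gaussianReal 0 1 := by
      rw [← (hlaw i).map_eq, lintegral_map' (by fun_prop) (hlaw i).aemeasurable]
    rw [h1, ← ofReal_integral_eq_lintegral_ofReal hi (ae_of_all _ fun x => sq_nonneg x)]
    have h2 := variance_eq_sub (memLp_id_gaussianReal (μ := 0) (v := 1) 2)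
    simp at h2
    simp [← h2]
  have hfin : ∫⁻ ω, ∑' i, ENNReal.ofReal (q i) * ENNReal.ofReal (ξ i ω ^ 2) ∂P ≠ ⊤ := by
    rw [lintegral_tsum (fun i =>
      (((hlaw i).aemeasurable.pow_const 2).ennreal_ofReal).const_mul _)]
    refine ne_top_of_le_ne_top hqs.tsum_ofReal_ne_top (ENNReal.tsum_le_tsum fun i => ?_)
    rw [lintegral_const_mul' _ _ ENNReal.ofReal_ne_top]
    exact mul_le_of_le_one_right zero_le (hξ2 i)
  have hae := ae_lt_top' (AEMeasurable.tsum fun i =>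
      (((hlaw i).aemeasurable.pow_const 2).ennreal_ofReal).const_mul _) hfin
  filter_upwards [hae] with ω hω
  have hs : Summable fun i => q i * ξ i ω ^ 2 := by
    have := ENNReal.summable_toReal hω.ne
    refine this.congr fun i => ?_
    rw [ENNReal.toReal_mul, ENNReal.toReal_ofReal (hq i), ENNReal.toReal_ofReal (sq_nonneg _)]
  refine Summable.of_nonneg_of_le (fun i => mul_nonneg (hq i) (sq_nonneg _)) (fun i => ?_)
    ((hqa.add hs).mul_left 2)
  nlinarith [mul_nonneg (hq i) (sq_nonneg (a i - ξ i ω))]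

/-- Reduction of tail bounds for the infinite quadratic form to its partial sums. -/
lemma quadForm_measureReal_le [IsProbabilityMeasure P] [Countable ι]
    (hlaw : ∀ i, HasLaw (ξ i) (gaussianReal 0 1) P)
    {q a : ι → ℝ} (hq : ∀ i, 0 ≤ q i) (hqs : Summable q) (hqa : Summable fun i => q i * a i ^ 2)
    {U : Set ℝ} (hU : IsOpen U) {p : ℝ}
    (hp : ∀ᶠ F in atTop, P.real {ω | partialQuad q a ξ F ω ∈ U} ≤ p) :
    P.real {ω | quadForm q a ξ ω ∈ U} ≤ p := by
  obtain ⟨u, hu⟩ := (atTop : Filter (Finset ι)).exists_seq_tendsto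
  refine measureReal_le_of_ae_tendsto (T := fun n => partialQuad q a ξ (u n)) ?_ hU
    (hu.eventually hp)
  filter_upwards [ae_summable_quad hlaw hq hqs hqa] with ω hω
  exact (tendsto_partialQuad hqs hω).comp hu

variable [IsProbabilityMeasure P] [Countable ι]

/-- Chernoff's bound at t. As t q_i ≤ 1/4, the factor 1/(1 - 2 t q_i) is at most 2, so the drift is
counted at most twice. -/
lemma quadForm_upper_tail (hind : iIndepFun ξ P) (hlaw : ∀ i, HasLaw (ξ i) (gaussianReal 0 1) P)
    {q a : ι → ℝ} (hq : ∀ i, 0 ≤ q i) (hqs : Summable q) (hq2 : Summable fun i => q i ^ 2)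
    (hqa : Summable fun i => q i * a i ^ 2) {t : ℝ} (ht0 : 0 ≤ t) (ht : ∀ i, t * q i ≤ 1 / 4)
    (x : ℝ) :
    P.real {ω | x < quadForm q a ξ ω} ≤
      Real.exp (-t * x + (4 * t ^ 2 * ∑' i, q i ^ 2 + 2 * t * ∑' i, q i * a i ^ 2)) := by
  refine quadForm_measureReal_le hlaw hq hqs hqa (U := Set.Ioi x) isOpen_Ioi
    (Eventually.of_forall fun F => ?_)
  have h0 : ∀ i, 0 ≤ t * q i := fun i => mul_nonneg ht0 (hq i)
  calc P.real {ω | partialQuad q a ξ F ω ∈ Set.Ioi x}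
      ≤ P.real {ω | x ≤ partialQuad q a ξ F ω} :=
        measureReal_mono fun ω (h : x < _) => h.le
    _ ≤ Real.exp (-t * x) * mgf (partialQuad q a ξ F) P t :=
      measure_ge_le_exp_mul_mgf x ht0
        (integrable_exp_partialQuad hind hlaw q a F fun i => by linarith [ht i])
    _ ≤ Real.exp (-t * x) * Real.exp (4 * t ^ 2 * ∑ i ∈ F, q i ^ 2 +
        ∑ i ∈ F, t * q i * a i ^ 2 / (1 - 2 * (t * q i))) := by
      gcongr
      exact mgf_partialQuad_le hind hlaw q a F fun i => by
        rw [abs_of_nonneg (h0 i)]; exact ht i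
    _ ≤ _ := by
      rw [← Real.exp_add]
      gcongr
      · exact hq2.sum_le_tsum F fun i _ => sq_nonneg _
      · calc ∑ i ∈ F, t * q i * a i ^ 2 / (1 - 2 * (t * q i))
            ≤ ∑ i ∈ F, 2 * t * (q i * a i ^ 2) := by
              refine Finset.sum_le_sum fun i _ => ?_
              rw [div_le_iff₀ (by linarith [ht i])]
              have := mul_nonneg (h0 i) (sq_nonneg (a i))
              nlinarith [ht i, mul_nonneg this (sub_nonneg.2 (ht i))]
          _ = 2 * t * ∑ i ∈ F, q i * a i ^ 2 := by rw [Finset.mul_sum]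
          _ ≤ _ := by
            gcongr
            exact hqa.sum_le_tsum F fun i _ => mul_nonneg (hq i) (sq_nonneg _)

/-- Chernoff's bound at -t, where 1/(1 + 2 t q_i) ≥ 1/2 keeps half of the drift. The slack in d lets
large finite partial sums already exceed it. -/
lemma quadForm_lower_tail (hind : iIndepFun ξ P) (hlaw : ∀ i, HasLaw (ξ i) (gaussianReal 0 1) P)
    {q a : ι → ℝ} (hq : ∀ i, 0 ≤ q i) (hqs : Summable q) (hq2 : Summable fun i => q i ^ 2)
    (hqa : Summable fun i => q i * a i ^ 2) {t : ℝ} (ht0 : 0 ≤ t) (ht : ∀ i, t * q i ≤ 1 / 4)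
    {d : ℝ} (hd : d < ∑' i, q i * a i ^ 2) (x : ℝ) :
    P.real {ω | quadForm q a ξ ω < x} ≤
      Real.exp (t * x + (4 * t ^ 2 * ∑' i, q i ^ 2 - t / 2 * d)) := by
  refine quadForm_measureReal_le hlaw hq hqs hqa (U := Set.Iio x) isOpen_Iio ?_
  filter_upwards [hqa.hasSum.eventually (lt_mem_nhds hd)] with F hF
  have h0 : ∀ i, 0 ≤ t * q i := fun i => mul_nonneg ht0 (hq i)
  calc P.real {ω | partialQuad q a ξ F ω ∈ Set.Iio x}
      ≤ P.real {ω | partialQuad q a ξ F ω ≤ x} :=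
        measureReal_mono fun ω (h : _ < x) => h.le
    _ ≤ Real.exp (-(-t) * x) * mgf (partialQuad q a ξ F) P (-t) :=
      measure_le_le_exp_mul_mgf x (by linarith)
        (integrable_exp_partialQuad hind hlaw q a F fun i => by linarith [h0 i])
    _ ≤ Real.exp (-(-t) * x) * Real.exp (4 * (-t) ^ 2 * ∑ i ∈ F, q i ^ 2 +
        ∑ i ∈ F, -t * q i * a i ^ 2 / (1 - 2 * (-t * q i))) := by
      gcongr
      exact mgf_partialQuad_le hind hlaw q a F fun i => by
        rw [neg_mul, abs_neg, abs_of_nonneg (h0 i)]; exact ht i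
    _ ≤ _ := by
      rw [← Real.exp_add, neg_neg, neg_sq, sub_eq_add_neg]
      gcongr
      · exact hq2.sum_le_tsum F fun i _ => sq_nonneg _
      · calc ∑ i ∈ F, -t * q i * a i ^ 2 / (1 - 2 * (-t * q i))
            ≤ ∑ i ∈ F, -(t / 2) * (q i * a i ^ 2) := by
              refine Finset.sum_le_sum fun i _ => ?_
              rw [div_le_iff₀ (by linarith [h0 i])]
              have := mul_nonneg (h0 i) (sq_nonneg (a i))
              nlinarith [ht i, mul_nonneg this (sub_nonneg.2 (ht i))]
          _ = -(t / 2 * ∑ i ∈ F, q i * a i ^ 2) := by rw [← Finset.mul_sum]; ring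
          _ ≤ _ := by gcongr

/-- Paley–Zygmund for exp(tX) with V = ∑ q_i²: the mgf is at least exp(t²V) at t and at most
exp(16t²V) at 2t, and exp(tX) above half its mean forces X > tV - log 2 / t. -/
lemma quadForm_tail_ge (hind : iIndepFun ξ P) (hlaw : ∀ i, HasLaw (ξ i) (gaussianReal 0 1) P)
    {q : ι → ℝ} (hq : ∀ i, 0 ≤ q i) (hqs : Summable q) (hq2 : Summable fun i => q i ^ 2)
    {t : ℝ} (ht0 : 0 < t) (ht : ∀ i, 2 * t * q i ≤ 1 / 4)
    {x : ℝ} (hx : x < t * ∑' i, q i ^ 2 - Real.log 2 / t) :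
    Real.exp (-(16 * t ^ 2 * ∑' i, q i ^ 2)) / 4 ≤ P.real {ω | x ≤ quadForm q 0 ξ ω} := by
  -- Only upper bounds for open sets pass to the limit, so the complementary event is bounded.
  have key : P.real {ω | quadForm q 0 ξ ω < x} ≤
      1 - Real.exp (-(16 * t ^ 2 * ∑' i, q i ^ 2)) / 4 := by
    refine quadForm_measureReal_le hlaw hq hqs (by simp)
      (U := Set.Iio x) isOpen_Iio ?_
    have hlim : Tendsto (fun F : Finset ι => t * ∑ i ∈ F, q i ^ 2 - Real.log 2 / t) atTop
        (𝓝 (t * ∑' i, q i ^ 2 - Real.log 2 / t)) := (hq2.hasSum.const_mul t).sub_const _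
    filter_upwards [hlim.eventually (lt_mem_nhds hx)] with F hF
    set X := partialQuad q 0 ξ F with hX
    have h0 : ∀ i, 0 ≤ t * q i := fun i => mul_nonneg ht0.le (hq i)
    have h1 : Integrable (fun ω => Real.exp (t * X ω)) P :=
      integrable_exp_partialQuad hind hlaw q 0 F fun i => by linarith [ht i, h0 i]
    have h2 : Integrable (fun ω => Real.exp (2 * t * X ω)) P :=
      integrable_exp_partialQuad hind hlaw q 0 F fun i => by linarith [ht i, h0 i]
    have hV : ∑ i ∈ F, q i ^ 2 ≤ ∑' i, q i ^ 2 := hq2.sum_le_tsum F fun i _ => sq_nonneg _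
    have hm : Real.exp (t ^ 2 * ∑ i ∈ F, q i ^ 2) ≤ mgf X P t :=
      exp_le_mgf_partialQuad hind hlaw hq F ht0.le fun i => by linarith [ht i, h0 i]
    have hM : mgf X P (2 * t) ≤ Real.exp (16 * t ^ 2 * ∑' i, q i ^ 2) := by
      refine (mgf_partialQuad_le hind hlaw q 0 F fun i => ?_).trans ?_
      · rw [abs_of_nonneg (by nlinarith [h0 i])]; exact ht i
      · rw [Real.exp_le_exp]
        simp only [Pi.zero_apply, ne_eq, OfNat.ofNat_ne_zero, not_false_eq_true, zero_pow,
          mul_zero, zero_div, Finset.sum_const_zero, add_zero]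
        calc 4 * (2 * t) ^ 2 * ∑ i ∈ F, q i ^ 2 = 16 * t ^ 2 * ∑ i ∈ F, q i ^ 2 := by ring
          _ ≤ _ := by gcongr
    have hpz := sq_mgf_le_measureReal h1 h2
    have hlow : Real.exp (-(16 * t ^ 2 * ∑' i, q i ^ 2)) / 4 ≤
        P.real {ω | mgf X P t / 2 < Real.exp (t * X ω)} := by
      refine le_trans ?_ hpz
      have hm1 : 1 ≤ mgf X P t := le_trans (Real.one_le_exp (by positivity)) hm
      have hM0 : 0 < mgf X P (2 * t) := mgf_pos h2
      rw [div_le_div_iff₀ (by norm_num) (by positivity), Real.exp_neg]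
      have : (Real.exp (16 * t ^ 2 * ∑' i, q i ^ 2))⁻¹ * mgf X P (2 * t) ≤ 1 := by
        rw [inv_mul_le_iff₀ (Real.exp_pos _), mul_one]; exact hM
      nlinarith
    have hsub : {ω | mgf X P t / 2 < Real.exp (t * X ω)} ⊆ {ω | x ≤ X ω} := by
      intro ω (hω : mgf X P t / 2 < Real.exp (t * X ω))
      have h3 : Real.exp (t ^ 2 * ∑ i ∈ F, q i ^ 2 - Real.log 2) < Real.exp (t * X ω) := by
        rw [Real.exp_sub, Real.exp_log two_pos]
        exact lt_of_le_of_lt (by gcongr) hω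
      have h4 := Real.exp_lt_exp.1 h3
      have h5 : t * (t * ∑ i ∈ F, q i ^ 2 - Real.log 2 / t) < t * X ω := by
        have : t * (t * ∑ i ∈ F, q i ^ 2 - Real.log 2 / t) =
          t ^ 2 * ∑ i ∈ F, q i ^ 2 - Real.log 2 := by field_simp
        rwa [this]
      exact (hF.trans (lt_of_mul_lt_mul_left h5 ht0.le)).le
    have hXm : AEMeasurable X P := by
      have : X = fun ω => ∑ i ∈ F, q i * (((0 : ι → ℝ) i + ξ i ω) ^ 2 - 1) := rfl
      rw [this]
      have := fun i => (hlaw i).aemeasurable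
      fun_prop
    have hcompl : {ω | X ω ∈ Set.Iio x} = {ω | x ≤ X ω}ᶜ := by ext ω; simp
    rw [hcompl, probReal_compl_eq_one_sub₀ (nullMeasurableSet_le aemeasurable_const hXm)]
    linarith [measureReal_mono (μ := P) hsub]
  have hcov : 1 ≤ P.real {ω | quadForm q 0 ξ ω < x} + P.real {ω | x ≤ quadForm q 0 ξ ω} := by
    have : (Set.univ : Set Ω) = {ω | quadForm q 0 ξ ω < x} ∪ {ω | x ≤ quadForm q 0 ξ ω} := by
      ext ω; simp [lt_or_ge]
    rw [← probReal_univ (μ := P), this]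
    exact measureReal_union_le _ _
  linarith

end QuadForm

/-! ### White noise in the coordinates of an orthonormal basis -/

section WhiteNoise

variable {Ω : Type*} [MeasurableSpace Ω] {P : Measure Ω} {W : L2 → Ω → ℝ}

lemma IsWhiteNoise.hasLaw (hW : IsWhiteNoise P W) {f : L2} (hf : ‖f‖ = 1) :
    HasLaw (W f) (gaussianReal 0 1) P := by
  have h := hW.isGaussianProcess.hasGaussianLaw_eval f
  refine ⟨h.aemeasurable, ?_⟩
  have hvar : Var[W f; P] = 1 := by
    rw [← covariance_self h.aemeasurable, hW.covariance_eq, real_inner_self_eq_norm_sq, hf]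
    norm_num
  rw [h.map_eq_gaussianReal, hvar, hW.mean_eq_zero, Real.toNNReal_one]

/-- Orthogonality means zero covariance, which for jointly Gaussian variables is independence; each
variable is viewed as a process over `Unit`. -/
lemma IsWhiteNoise.iIndepFun (hW : IsWhiteNoise P W) {ι : Type*} {v : ι → L2}
    (hv : Orthonormal ℝ v) : iIndepFun (fun i => W (v i)) P := by
  have h := IsGaussianProcess.iIndepFun_of_covariance_eq_zero
    (X := fun (i : ι) (_ : Unit) => W (v i))
    (hW.isGaussianProcess.comp_right fun p : (_ : ι) × Unit => v p.1)
    (fun i _ => (hW.isGaussianProcess.hasGaussianLaw_eval (v i)).aemeasurable)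
    (fun i j hij _ _ => by rw [hW.covariance_eq]; exact hv.2 hij)
  exact h.comp (fun _ (x : Unit → ℝ) => x ()) fun _ => measurable_pi_apply _

end WhiteNoise

/-! ### Parseval's identity for the Fourier coefficients -/

section Coefficients

variable (φ : HilbertBasis ℕ+ ℝ L2)

lemma hasSum_fourier_mul (S S' : L2) :
    HasSum (fun j => fourier φ S j * fourier φ S' j) (inner ℝ S S') := by
  refine (φ.hasSum_inner_mul_inner S S').congr_fun fun j => ?_
  simp [fourier, real_inner_comm]

lemma hasSum_fourier_sq (S : L2) : HasSum (fun j => fourier φ S j ^ 2) (‖S‖ ^ 2) := by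
  rw [← real_inner_self_eq_norm_sq]
  exact (hasSum_fourier_mul φ S S).congr_fun fun j => by ring

end Coefficients

/-! ### Orders of magnitude of the weights -/

section Weights

variable {ϰ : ℝ → ℕ → ℝ}

lemma A1.le_first (h : A1 ϰ) {ε : ℝ} (hε : 0 < ε) (j : ℕ+) : ϰ ε j ^ 2 ≤ ϰ ε 1 ^ 2 :=
  h ε hε (Set.mem_Ici.2 le_rfl) (Set.mem_Ici.2 j.pos) j.pos

/-- A divergent `tsum` is `0`, so positivity of `bigA` already contains convergence. -/
lemma summable_pow_four_of_bigA_pos {ε : ℝ} (h : 0 < bigA ϰ ε) :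
    Summable fun j : ℕ+ => ϰ ε j ^ 4 := by
  by_contra hn
  rw [bigA, tsum_eq_zero_of_not_summable hn, mul_zero] at h
  exact h.false

lemma tsum_pow_four {ε : ℝ} (hε : 0 < ε) :
    ∑' j : ℕ+, ϰ ε j ^ 4 = ε ^ 4 * bigA ϰ ε := by
  rw [bigA, mul_inv_cancel_left₀ (by positivity)]

/-- By monotonicity each of the first k_ε terms of ∑ ϰ_j⁴ is at least ϰ_ε⁴. -/
lemma kIdx_mul_kappaSq_sq_le (hA1 : A1 ϰ) {ε : ℝ} (hε : 0 < ε) (hA : 0 < bigA ϰ ε) :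
    kIdx ϰ ε * kappaSq ϰ ε ^ 2 ≤ ε ^ 4 * bigA ϰ ε := by
  rw [← tsum_pow_four hε, tsum_pnat_eq_tsum_succ (f := fun j => ϰ ε j ^ 4)]
  have hs := (summable_pnat_iff_summable_succ (f := fun j => ϰ ε j ^ 4)).1
    (summable_pow_four_of_bigA_pos hA)
  refine le_trans ?_ (hs.sum_le_tsum (Finset.range (kIdx ϰ ε)) fun i _ => by positivity)
  calc kIdx ϰ ε * kappaSq ϰ ε ^ 2 = ∑ _i ∈ Finset.range (kIdx ϰ ε), kappaSq ϰ ε ^ 2 := by simp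
    _ ≤ _ := by
      refine Finset.sum_le_sum fun i hi => ?_
      have hi' : i + 1 ≤ kIdx ϰ ε := Finset.mem_range.1 hi
      have : kappaSq ϰ ε ≤ ϰ ε (i + 1) ^ 2 :=
        hA1 ε hε (Set.mem_Ici.2 (by omega)) (Set.mem_Ici.2 (by omega)) hi'
      calc kappaSq ϰ ε ^ 2 ≤ (ϰ ε (i + 1) ^ 2) ^ 2 :=
            pow_le_pow_left₀ (sq_nonneg _) this 2
        _ = _ := by ring

/-- A3 bounds `ϰ_{εj}²`, `j > k_ε`, by a multiple of `(k_ε / j) ϰ_ε²`. -/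
lemma A3.exists_le_div (h : A3 ϰ) : ∃ C > 0, ∀ ε > 0, ∀ j : ℕ, 1 ≤ kIdx ϰ ε → kIdx ϰ ε < j →
    ϰ ε j ^ 2 ≤ C * (kIdx ϰ ε / j) * kappaSq ϰ ε := by
  obtain ⟨C, hCpos, lam, hlam, hC⟩ := h
  refine ⟨C, hCpos, fun ε hε j hk hj => ?_⟩
  have hk' : (0 : ℝ) < kIdx ϰ ε := by exact_mod_cast hk
  have hj' : (kIdx ϰ ε : ℝ) < j := by exact_mod_cast hj
  -- This δ gives (1+δ) k_ε = j exactly, so the floor disappears.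
  have h0 := hC ((j - kIdx ϰ ε) / kIdx ϰ ε) (div_pos (by linarith) hk') ε hε
  have e : 1 + ((j : ℝ) - kIdx ϰ ε) / kIdx ϰ ε = j / kIdx ϰ ε := by field_simp; ring
  rw [e, div_mul_cancel₀ _ hk'.ne', Nat.floor_natCast] at h0
  refine h0.le.trans ?_
  have hκ : 0 ≤ kappaSq ϰ ε := sq_nonneg _
  gcongr
  calc ((j : ℝ) / kIdx ϰ ε) ^ (-lam) ≤ ((j : ℝ) / kIdx ϰ ε) ^ (-1 : ℝ) :=
        Real.rpow_le_rpow_of_exponent_le ((one_le_div hk').2 hj'.le) (by linarith)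
    _ = _ := by rw [Real.rpow_neg_one, inv_div]

/-- The k_ε head terms are at most (Bϰ_ε²)² each; the tail is at most C²ϰ_ε⁴ ∑_{j>k} (k/j)² ≤ 2C² k
ϰ_ε⁴. -/
lemma bigA_le_kIdx_mul_kappaSq_sq (hA1 : A1 ϰ) (hA3 : A3 ϰ) : ∃ C > 0, ∀ B > 0, ∀ ε > 0,
    1 ≤ kIdx ϰ ε → ϰ ε 1 ^ 2 ≤ B * kappaSq ϰ ε →
    ε ^ 4 * bigA ϰ ε ≤ (B ^ 2 + 2 * C ^ 2) * (kIdx ϰ ε * kappaSq ϰ ε ^ 2) := by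
  obtain ⟨C, hC, h⟩ := hA3.exists_le_div
  refine ⟨C, hC, fun B hB ε hε hk h1 => ?_⟩
  have hκ : 0 ≤ kappaSq ϰ ε := sq_nonneg _
  have hk' : (0 : ℝ) < kIdx ϰ ε := by exact_mod_cast hk
  set k := kIdx ϰ ε with hkdef
  rw [← tsum_pow_four hε, tsum_pnat_eq_tsum_succ (f := fun j => ϰ ε j ^ 4)]
  refine Real.tsum_le_of_sum_range_le (fun n => by positivity) fun N => ?_
  have e : ∑ i ∈ Finset.range N, ϰ ε (i + 1) ^ 4 = ∑ j ∈ Finset.Ioc 0 N, ϰ ε j ^ 4 := by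
    rw [Finset.range_eq_Ico, Finset.sum_Ico_add' (fun j => ϰ ε j ^ 4)]
    rfl
  have hsub : Finset.Ioc 0 N ⊆ Finset.Ioc 0 k ∪ Finset.Ioo k (N + 1) := by
    intro j hj
    simp only [Finset.mem_union, Finset.mem_Ioc, Finset.mem_Ioo] at hj ⊢
    omega
  have hdisj : Disjoint (Finset.Ioc 0 k) (Finset.Ioo k (N + 1)) := by
    rw [Finset.disjoint_left]
    intro j hj
    simp only [Finset.mem_Ioc, Finset.mem_Ioo] at hj ⊢
    omega
  have hhead : ∑ j ∈ Finset.Ioc 0 k, ϰ ε j ^ 4 ≤ B ^ 2 * (k * kappaSq ϰ ε ^ 2) := by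
    calc ∑ j ∈ Finset.Ioc 0 k, ϰ ε j ^ 4 ≤ ∑ _j ∈ Finset.Ioc 0 k, (B * kappaSq ϰ ε) ^ 2 := by
          refine Finset.sum_le_sum fun j hj => ?_
          have hj := (Finset.mem_Ioc.1 hj).1
          calc ϰ ε j ^ 4 = (ϰ ε j ^ 2) ^ 2 := by ring
            _ ≤ _ := pow_le_pow_left₀ (sq_nonneg _)
              ((hA1.le_first hε ⟨j, hj⟩).trans h1) 2
      _ = _ := by simp; ring
  have htail : ∑ j ∈ Finset.Ioo k (N + 1), ϰ ε j ^ 4 ≤ 2 * C ^ 2 * (k * kappaSq ϰ ε ^ 2) := by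
    calc ∑ j ∈ Finset.Ioo k (N + 1), ϰ ε j ^ 4
        ≤ ∑ j ∈ Finset.Ioo k (N + 1), (C * k * kappaSq ϰ ε) ^ 2 * ((j : ℝ) ^ 2)⁻¹ := by
          refine Finset.sum_le_sum fun j hj => ?_
          have hj := (Finset.mem_Ioo.1 hj).1
          calc ϰ ε j ^ 4 = (ϰ ε j ^ 2) ^ 2 := by ring
            _ ≤ (C * (k / j) * kappaSq ϰ ε) ^ 2 :=
              pow_le_pow_left₀ (sq_nonneg _) (h ε hε j hk hj) 2
            _ = _ := by ring
      _ = (C * k * kappaSq ϰ ε) ^ 2 * ∑ j ∈ Finset.Ioo k (N + 1), ((j : ℝ) ^ 2)⁻¹ := by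
          rw [Finset.mul_sum]
      _ ≤ (C * k * kappaSq ϰ ε) ^ 2 * (2 / k) := by
          gcongr
          refine (sum_Ioo_inv_sq_le k (N + 1)).trans ?_
          gcongr
          linarith
      _ = _ := by field_simp
  rw [e]
  calc ∑ j ∈ Finset.Ioc 0 N, ϰ ε j ^ 4
      ≤ ∑ j ∈ Finset.Ioc 0 k ∪ Finset.Ioo k (N + 1), ϰ ε j ^ 4 :=
        Finset.sum_le_sum_of_subset_of_nonneg hsub fun j _ _ => by positivity
    _ ≤ _ := by rw [Finset.sum_union hdisj]; linarith

/-- Under A1–A4 and `k_ε ≍ ε^{-4+8r+4w}` one has `ϰ_ε² ≍ ε^{4-4r-2w}`, and `ϰ_{εj}²` is of at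
most this order uniformly in `j`. -/
lemma kappaSq_bounds {r w : ℝ} (hA1 : A1 ϰ) (hA2 : A2 ϰ) (hA3 : A3 ϰ) (hA4 : A4 ϰ)
    (hk : (fun ε => (kIdx ϰ ε : ℝ)) =Θ[𝓝[>] (0 : ℝ)] fun ε => ε ^ (-4 + 8 * r + 4 * w)) :
    ∃ c > 0, ∃ C > 0, ∀ᶠ ε in 𝓝[>] (0 : ℝ), 1 ≤ kIdx ϰ ε ∧
      c * ε ^ (4 - 4 * r - 2 * w) ≤ kappaSq ϰ ε ∧ kappaSq ϰ ε ≤ C * ε ^ (4 - 4 * r - 2 * w) ∧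
      ∀ j : ℕ+, ϰ ε j ^ 2 ≤ C * ε ^ (4 - 4 * r - 2 * w) := by
  obtain ⟨a, ha, hka⟩ := hk.1.exists_pos
  obtain ⟨b, hb, hkb⟩ := hk.2.exists_pos
  obtain ⟨B, hB, h1⟩ := hA4.1.1.exists_pos
  obtain ⟨m₁, hm₁, m₂, hm₂, hA⟩ := hA2
  obtain ⟨D, hD, hV⟩ := bigA_le_kIdx_mul_kappaSq_sq hA1 hA3
  set G := (B ^ 2 + 2 * D ^ 2) with hG
  have hGpos : 0 < G := by positivity
  refine ⟨√(m₁ / (G * a)), by positivity, (B + 1) * √(m₂ * b), by positivity, ?_⟩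
  filter_upwards [hka.bound, hkb.bound, h1.bound, self_mem_nhdsWithin] with ε ha' hb' h1' hε
  have hε : 0 < ε := hε
  have hκ : 0 ≤ kappaSq ϰ ε := sq_nonneg _
  set E := ε ^ (4 - 4 * r - 2 * w) with hE
  set p := ε ^ (-4 + 8 * r + 4 * w) with hp
  have hEpos : 0 < E := Real.rpow_pos_of_pos hε _
  have hppos : 0 < p := Real.rpow_pos_of_pos hε _
  -- The exponent in E is the one that matches k_ε ϰ_ε⁴ ≍ ε⁴ with k_ε ≍ p.
  have hEp : E ^ 2 * p = ε ^ 4 := by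
    rw [hE, hp, ← Real.rpow_natCast, ← Real.rpow_mul hε.le, ← Real.rpow_add hε,
      ← Real.rpow_natCast]
    congr 1; push_cast; ring
  simp only [Real.norm_eq_abs, Nat.abs_cast, abs_of_pos hppos] at ha' hb'
  rw [Real.norm_of_nonneg (sq_nonneg _), Real.norm_of_nonneg hκ] at h1'
  have hkpos : (0 : ℝ) < kIdx ϰ ε := by
    by_contra hn
    nlinarith
  have hk1 : 1 ≤ kIdx ϰ ε := by exact_mod_cast hkpos
  have hup := kIdx_mul_kappaSq_sq_le hA1 hε (hm₁.trans (hA ε hε).1)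
  have hlow := hV B hB ε hε hk1 h1'
  have hA' := hA ε hε
  have hle : kappaSq ϰ ε ≤ √(m₂ * b) * E := by
    refine (pow_le_pow_iff_left₀ hκ (by positivity) two_ne_zero).1 ?_
    rw [mul_pow, Real.sq_sqrt (by positivity)]
    have h2 : p * kappaSq ϰ ε ^ 2 ≤ p * (m₂ * b * E ^ 2) := by
      calc p * kappaSq ϰ ε ^ 2 ≤ b * kIdx ϰ ε * kappaSq ϰ ε ^ 2 := by gcongr
        _ = b * (kIdx ϰ ε * kappaSq ϰ ε ^ 2) := by ring
        _ ≤ b * (ε ^ 4 * m₂) := mul_le_mul_of_nonneg_left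
          (hup.trans (mul_le_mul_of_nonneg_left hA'.2.le (by positivity))) hb.le
        _ = _ := by rw [← hEp]; ring
    exact le_of_mul_le_mul_left h2 hppos
  refine ⟨hk1, ?_, ?_, fun j => ?_⟩
  · refine (pow_le_pow_iff_left₀ (by positivity) hκ two_ne_zero).1 ?_
    rw [mul_pow, Real.sq_sqrt (by positivity), div_mul_eq_mul_div, div_le_iff₀ (by positivity)]
    have h2 : p * (m₁ * E ^ 2) ≤ p * (kappaSq ϰ ε ^ 2 * (G * a)) := by
      calc p * (m₁ * E ^ 2) = ε ^ 4 * m₁ := by rw [← hEp]; ring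
        _ ≤ ε ^ 4 * bigA ϰ ε := by gcongr; exact hA'.1.le
        _ ≤ G * (kIdx ϰ ε * kappaSq ϰ ε ^ 2) := hlow
        _ ≤ G * (a * p * kappaSq ϰ ε ^ 2) := by gcongr
        _ = _ := by ring
    exact le_of_mul_le_mul_left h2 hppos
  · refine hle.trans ?_
    have : 0 ≤ B * √(m₂ * b) * E := by positivity
    nlinarith
  · calc ϰ ε j ^ 2 ≤ B * kappaSq ϰ ε := (hA1.le_first hε j).trans h1'
      _ ≤ B * (√(m₂ * b) * E) := by gcongr
      _ ≤ _ := by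
        have : 0 ≤ √(m₂ * b) * E := by positivity
        nlinarith

end Weights

/-- The drift `ε⁻² ∑_j ϰ_{εj}² θ_j²` of the test statistic under the signal `S`. -/
def drift (φ : HilbertBasis ℕ+ ℝ L2) (ϰ : ℝ → ℕ → ℝ) (ε : ℝ) (S : L2) : ℝ :=
  ∑' j : ℕ+, ϰ ε j ^ 2 * (fourier φ S j / ε) ^ 2

/-! ### Non-asymptotic bounds for the error probabilities -/

section ErrorBounds

variable {Ω : Type*} [MeasurableSpace Ω] {P : Measure Ω}
  {W : L2 → Ω → ℝ} (φ : HilbertBasis ℕ+ ℝ L2) {ϰ : ℝ → ℕ → ℝ} {ε : ℝ}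

lemma summable_weight_mul_sq (hA1 : A1 ϰ) (hε : 0 < ε) (S : L2) :
    Summable fun j : ℕ+ => ϰ ε j ^ 2 * (fourier φ S j / ε) ^ 2 := by
  refine Summable.of_nonneg_of_le (fun j => by positivity) (fun j => ?_)
    ((hasSum_fourier_sq φ S).summable.mul_left (ϰ ε 1 ^ 2 / ε ^ 2))
  calc ϰ ε j ^ 2 * (fourier φ S j / ε) ^ 2 ≤ ϰ ε 1 ^ 2 * (fourier φ S j / ε) ^ 2 := by
        exact mul_le_mul_of_nonneg_right (hA1.le_first hε j) (sq_nonneg _)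
    _ = _ := by rw [div_pow]; ring

lemma drift_nonneg (S : L2) : 0 ≤ drift φ ϰ ε S := tsum_nonneg fun j => by positivity

omit [MeasurableSpace Ω] in
lemma stat_eq_quadForm (hε : 0 < ε) (S : L2) (ω : Ω) :
    stat W φ ϰ ε S ω = quadForm (fun j : ℕ+ => ϰ ε j ^ 2) (fun j => fourier φ S j / ε)
      (fun j => W (φ j)) ω := by
  rw [stat, quadForm, rhoSq, ← tsum_mul_left]
  congr 1
  refine tsum_congr fun j => ?_
  rw [obs]
  field_simp

omit [MeasurableSpace Ω] in
lemma rejects_eq (hε : 0 < ε) (hA : 0 < bigA ϰ ε) (S : L2) (x : ℝ) :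
    rejects W φ ϰ ε S x = {ω | √(bigA ϰ ε) * x < quadForm (fun j : ℕ+ => ϰ ε j ^ 2)
      (fun j => fourier φ S j / ε) (fun j => W (φ j)) ω} := by
  ext ω
  have hs : 0 < √(bigA ϰ ε) := Real.sqrt_pos.2 hA
  have e : bigA ϰ ε ^ (-(1 / 2) : ℝ) = (√(bigA ϰ ε))⁻¹ := by
    rw [Real.rpow_neg hA.le, Real.sqrt_eq_rpow]
  simp only [rejects, Set.mem_ofPred_eq, stat_eq_quadForm φ hε, e]
  rw [lt_inv_mul_iff₀ hs]

lemma tsum_weight_sq (hε : 0 < ε) :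
    ∑' j : ℕ+, (ϰ ε j ^ 2) ^ 2 = ε ^ 4 * bigA ϰ ε := by
  rw [← tsum_pow_four hε]
  exact tsum_congr fun j => by ring

lemma summable_weight_sq (hA : 0 < bigA ϰ ε) : Summable fun j : ℕ+ => (ϰ ε j ^ 2) ^ 2 :=
  (summable_pow_four_of_bigA_pos hA).congr fun j => by ring

lemma fourier_zero_div : (fun j => fourier φ 0 j / ε) = 0 := by
  ext j; simp [fourier]

variable [IsProbabilityMeasure P] (hW : IsWhiteNoise P W) (hε : 0 < ε) (hA : 0 < bigA ϰ ε)
  (hsum : Summable fun j : ℕ+ => ϰ ε j ^ 2)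

include hW hε hA hsum

lemma typeI_le {t : ℝ} (ht0 : 0 ≤ t) (ht : ∀ j : ℕ+, t * ϰ ε j ^ 2 ≤ 1 / 4) (x : ℝ) :
    typeI P W φ ϰ ε x ≤
      Real.exp (-t * (√(bigA ϰ ε) * x) + 4 * t ^ 2 * (ε ^ 4 * bigA ϰ ε)) := by
  have := quadForm_upper_tail (hW.iIndepFun φ.orthonormal)
    (fun j => hW.hasLaw (φ.orthonormal.1 j)) (fun j => sq_nonneg (ϰ ε j)) hsum
    (summable_weight_sq hA) (a := 0) (by simp) ht0 ht (√(bigA ϰ ε) * x)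
  rw [tsum_weight_sq hε] at this
  rw [typeI, rejects_eq φ hε hA, fourier_zero_div]
  simpa using this

lemma le_typeI {t : ℝ} (ht0 : 0 < t) (ht : ∀ j : ℕ+, 2 * t * ϰ ε j ^ 2 ≤ 1 / 4) {x : ℝ}
    (hx : √(bigA ϰ ε) * x < t * (ε ^ 4 * bigA ϰ ε) - Real.log 2 / t) :
    Real.exp (-(16 * t ^ 2 * (ε ^ 4 * bigA ϰ ε))) / 4 ≤ typeI P W φ ϰ ε x := by
  -- The tail bound concerns a closed half-line while rejection is strict; the intermediate level y
  -- absorbs the difference.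
  obtain ⟨y, hy1, hy2⟩ := exists_between hx
  rw [← tsum_weight_sq hε] at hy2 ⊢
  refine (quadForm_tail_ge (hW.iIndepFun φ.orthonormal)
    (fun j => hW.hasLaw (φ.orthonormal.1 j)) (fun j => sq_nonneg (ϰ ε j)) hsum
    (summable_weight_sq hA) ht0 ht hy2).trans ?_
  rw [typeI, rejects_eq φ hε hA, fourier_zero_div]
  exact measureReal_mono fun ω h => hy1.trans_le h

lemma typeII_le (hA1 : A1 ϰ) {t : ℝ} (ht0 : 0 ≤ t) (ht : ∀ j : ℕ+, t * ϰ ε j ^ 2 ≤ 1 / 4)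
    {S : L2} {d : ℝ} (hd : d < drift φ ϰ ε S) {x y : ℝ} (hy : √(bigA ϰ ε) * x < y) :
    typeII P W φ ϰ ε S x ≤
      Real.exp (t * y + (4 * t ^ 2 * (ε ^ 4 * bigA ϰ ε) - t / 2 * d)) := by
  rw [typeII, rejects_eq φ hε hA, ← tsum_weight_sq hε]
  refine le_trans (measureReal_mono fun ω h => ?_)
    (quadForm_lower_tail (hW.iIndepFun φ.orthonormal)
    (fun j => hW.hasLaw (φ.orthonormal.1 j)) (fun j => sq_nonneg (ϰ ε j)) hsum
    (summable_weight_sq hA) (summable_weight_mul_sq φ hA1 hε S) ht0 ht hd y)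
  simp only [Set.mem_compl_iff, Set.mem_ofPred_eq, not_lt] at h
  exact h.trans_lt hy

lemma le_typeII (hA1 : A1 ϰ) {t : ℝ} (ht0 : 0 ≤ t) (ht : ∀ j : ℕ+, t * ϰ ε j ^ 2 ≤ 1 / 4)
    (S : L2) (x : ℝ) :
    1 - Real.exp (-t * (√(bigA ϰ ε) * x) +
      (4 * t ^ 2 * (ε ^ 4 * bigA ϰ ε) + 2 * t * drift φ ϰ ε S)) ≤ typeII P W φ ϰ ε S x := by
  have h := quadForm_upper_tail (hW.iIndepFun φ.orthonormal)
    (fun j => hW.hasLaw (φ.orthonormal.1 j)) (fun j => sq_nonneg (ϰ ε j)) hsum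
    (summable_weight_sq hA) (summable_weight_mul_sq φ hA1 hε S) ht0 ht (√(bigA ϰ ε) * x)
  rw [← rejects_eq φ hε hA, tsum_weight_sq hε] at h
  have hu : 1 ≤ P.real (rejects W φ ϰ ε S x) + P.real (rejects W φ ϰ ε S x)ᶜ := by
    rw [← probReal_univ (μ := P), ← Set.union_compl_self (rejects W φ ϰ ε S x)]
    exact measureReal_union_le _ _
  rw [typeII]
  unfold drift
  linarith

end ErrorBounds

/-! ### Consistency and the size of the drift -/

section Consistency

lemma tendsto_rpow_nhdsGT_zero {s : ℝ} (hs : 0 < s) :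
    Tendsto (fun ε : ℝ => ε ^ s) (𝓝[>] 0) (𝓝 0) := by
  have h := (Real.continuousAt_rpow_const 0 s (Or.inr hs.le)).tendsto
  rw [Real.zero_rpow hs.ne'] at h
  exact h.mono_left nhdsWithin_le_nhds

lemma rpow_neg_two_mul {ε : ℝ} (hε : 0 < ε) (w : ℝ) : ε ^ (-2 * w) = (ε ^ (2 * w))⁻¹ := by
  rw [← Real.rpow_neg hε.le]; ring_nf

/-- Admissibility of the tilt τR/ε²: its product with ϰ_j² is O(ε^{2-4r-4w}) uniformly in j, and the
exponent is positive exactly when 2w < 1 - 2r. -/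
lemma eventually_mul_weight_le {ϰ : ℝ → ℕ → ℝ} {r w C : ℝ}
    (hw₁ : 2 * w < 1 - 2 * r)
    (hM : ∀ᶠ ε in 𝓝[>] (0 : ℝ), ∀ j : ℕ+, ϰ ε j ^ 2 ≤ C * ε ^ (4 - 4 * r - 2 * w))
    {τ : ℝ} (hτ : 0 < τ) :
    ∀ᶠ ε in 𝓝[>] (0 : ℝ), ∀ j : ℕ+, τ * ε ^ (-2 * w) / ε ^ 2 * ϰ ε j ^ 2 ≤ 1 / 8 := by
  have h := (tendsto_rpow_nhdsGT_zero (s := 2 - 4 * r - 4 * w) (by linarith)).const_mul (τ * C)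
  rw [mul_zero] at h
  filter_upwards [hM, h.eventually (gt_mem_nhds (show (0 : ℝ) < 1 / 8 by norm_num)),
    self_mem_nhdsWithin] with ε hε1 hε2 hε j
  have hε : 0 < ε := hε
  refine le_trans ?_ hε2.le
  have hR := Real.rpow_pos_of_pos hε (-2 * w)
  calc τ * ε ^ (-2 * w) / ε ^ 2 * ϰ ε j ^ 2
      ≤ τ * ε ^ (-2 * w) / ε ^ 2 * (C * ε ^ (4 - 4 * r - 2 * w)) := by gcongr; exact hε1 j
    _ = τ * C * (ε ^ (-2 * w) * ε ^ (4 - 4 * r - 2 * w) / ε ^ (2 : ℝ)) := by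
      rw [Real.rpow_two]; ring
    _ = _ := by
      rw [← Real.rpow_add hε, ← Real.rpow_sub hε]; ring_nf

variable {Ω : Type*} [MeasurableSpace Ω] {P : Measure Ω} [IsProbabilityMeasure P]
  {W : L2 → Ω → ℝ} (hW : IsWhiteNoise P W) (φ : HilbertBasis ℕ+ ℝ L2) {ϰ : ℝ → ℕ → ℝ}
  {r w C : ℝ} (hw₀ : 0 < 2 * w) (hw₁ : 2 * w < 1 - 2 * r)
  (hsum : ∀ ε > 0, Summable fun j : ℕ+ => ϰ ε j ^ 2) (hA1 : A1 ϰ) (hA2 : A2 ϰ)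
  (hM : ∀ᶠ ε in 𝓝[>] (0 : ℝ), ∀ j : ℕ+, ϰ ε j ^ 2 ≤ C * ε ^ (4 - 4 * r - 2 * w))
  {ι : Type*} {l : Filter ι} {e : ι → ℝ} (he : Tendsto e l (𝓝[>] 0)) {S : ι → L2}

include hW hw₁ hsum hA2 hM he

/-- A test whose size is not exponentially small has a critical value of smaller order. -/
lemma eventually_critical_value_lt {x : ι → ℝ}
    (hpos : ∀ᶠ i in l, 0 < typeI P W φ ϰ (e i) (x i))
    (hx : Tendsto (fun i => ((e i ^ (-2 * w)) ^ 2)⁻¹ *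
      Real.log (typeI P W φ ϰ (e i) (x i))) l (𝓝 0)) {η : ℝ} (hη : 0 < η) :
    ∀ᶠ i in l, √(bigA ϰ (e i)) * x i < η * e i ^ (-2 * w) * e i ^ 2 := by
  obtain ⟨m₁, hm₁, m₂, hm₂, hA⟩ := hA2
  -- With this τ the quadratic Chernoff term is at most half of the linear gain τηR², so a larger
  -- critical value would force log α ≤ -τηR²/2.
  set τ := η / (8 * m₂) with hτ
  have hτpos : 0 < τ := by positivity
  have hneg : -(τ * η / 2) < 0 := by
    have : 0 < τ * η / 2 := by positivity
    linarith
  filter_upwards [hpos, hx.eventually (lt_mem_nhds hneg),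
    he.eventually (eventually_mul_weight_le hw₁ hM hτpos),
    he.eventually self_mem_nhdsWithin] with i hα hlog hsmall hε
  have hε : 0 < e i := hε
  by_contra! hge
  set ε := e i with hεdef
  set R := ε ^ (-2 * w) with hRdef
  have hR : 0 < R := Real.rpow_pos_of_pos hε _
  have hAi := hA ε hε
  have hle := typeI_le φ hW hε (hm₁.trans hAi.1) (hsum ε hε) (t := τ * R / ε ^ 2)
    (by positivity) (fun j => (hsmall j).trans (by norm_num)) (x i)
  have hlogle := Real.log_le_log hα hle
  rw [Real.log_exp] at hlogle
  have h1 : τ * R / ε ^ 2 * (η * R * ε ^ 2) ≤ τ * R / ε ^ 2 * (√(bigA ϰ ε) * x i) := by gcongr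
  have h2 : τ * R / ε ^ 2 * (η * R * ε ^ 2) = R ^ 2 * (τ * η) := by field_simp
  have h3 : 4 * (τ * R / ε ^ 2) ^ 2 * (ε ^ 4 * bigA ϰ ε) ≤ R ^ 2 * (τ * η / 2) := by
    calc 4 * (τ * R / ε ^ 2) ^ 2 * (ε ^ 4 * bigA ϰ ε) = 4 * τ ^ 2 * R ^ 2 * bigA ϰ ε := by
          field_simp
      _ ≤ 4 * τ ^ 2 * R ^ 2 * m₂ := by gcongr; exact hAi.2.le
      _ = _ := by rw [hτ]; field_simp; norm_num
  rw [inv_mul_eq_div, lt_div_iff₀ (by positivity)] at hlog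
  linarith

include hA1 in
/-- If the drift is at least of order `ε^{2-2w}`, then the alternatives are consistent. -/
lemma ldConsistent_of_le_drift {c : ℝ} (hc : 0 < c)
    (hD : ∀ᶠ i in l, c * e i ^ (-2 * w) * e i ^ 2 ≤ drift φ ϰ (e i) (S i)) :
    LDConsistent P W φ ϰ l e (fun i => e i ^ (-2 * w)) S := by
  intro x hpos hx
  have hη : 0 < c / 32 := by positivity
  have hcrit := eventually_critical_value_lt hW φ hw₁ hsum hA2 hM he hpos hx hη
  obtain ⟨m₁, hm₁, m₂, hm₂, hA⟩ := hA2
  -- In units of τcR² the exponent is at most 1/32 (critical value) + 1/16 (quadratic term) - 1/4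
  -- (drift), which is below -1/8.
  set τ := c / (64 * m₂) with hτ
  have hτpos : 0 < τ := by positivity
  refine ⟨τ * c / 8, by positivity, ?_⟩
  filter_upwards [hcrit, hD, he.eventually (eventually_mul_weight_le hw₁ hM hτpos),
    he.eventually self_mem_nhdsWithin] with i hxi hDi hsmall hε
  have hε : 0 < e i := hε
  set ε := e i with hεdef
  set R := ε ^ (-2 * w) with hRdef
  have hR : 0 < R := Real.rpow_pos_of_pos hε _
  have hAi := hA ε hε
  have hd : c / 2 * R * ε ^ 2 < drift φ ϰ ε (S i) := by
    refine lt_of_lt_of_le ?_ hDi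
    gcongr
    linarith
  have hle := typeII_le φ hW hε (hm₁.trans hAi.1) (hsum ε hε) hA1 (t := τ * R / ε ^ 2)
    (by positivity) (fun j => (hsmall j).trans (by norm_num)) hd hxi
  refine hle.trans (Real.exp_le_exp.2 ?_)
  have h1 : τ * R / ε ^ 2 * (c / 32 * R * ε ^ 2) = τ * c * R ^ 2 / 32 := by field_simp
  have h2 : τ * R / ε ^ 2 / 2 * (c / 2 * R * ε ^ 2) = τ * c * R ^ 2 / 4 := by field_simp; norm_num
  have h3 : 4 * (τ * R / ε ^ 2) ^ 2 * (ε ^ 4 * bigA ϰ ε) ≤ τ * c * R ^ 2 / 16 := by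
    calc 4 * (τ * R / ε ^ 2) ^ 2 * (ε ^ 4 * bigA ϰ ε) = 4 * τ ^ 2 * R ^ 2 * bigA ϰ ε := by
          field_simp
      _ ≤ 4 * τ ^ 2 * R ^ 2 * m₂ := by gcongr; exact hAi.2.le
      _ = _ := by rw [hτ]; field_simp; norm_num
  rw [h1, h2]
  have : 0 ≤ τ * c * R ^ 2 := by positivity
  linarith

include hA1 hw₀ in
/-- If the drift is of smaller order than `ε^{2-2w}`, then the alternatives are inconsistent. -/
lemma not_ldConsistent_of_drift_le [l.NeBot] {δ : ι → ℝ} (hδ : Tendsto δ l (𝓝 0))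
    (hD : ∀ᶠ i in l, drift φ ϰ (e i) (S i) ≤ δ i * e i ^ (-2 * w) * e i ^ 2) :
    ¬ LDConsistent P W φ ϰ l e (fun i => e i ^ (-2 * w)) S := by
  intro hcons
  obtain ⟨m₁, hm₁, m₂, hm₂, hA⟩ := hA2
  -- K makes the exponent in the type II bound at tilt 1/ε² at most -1. L makes L A_ε ≥ 2, so that
  -- the lower bound for α reaches the chosen critical value.
  set K := 4 * m₂ + 1 with hK
  have hKpos : 1 ≤ K := by linarith
  set L := 2 / m₁ + 1 with hL
  have hLpos : 1 ≤ L := by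
    have : 0 < 2 / m₁ := by positivity
    linarith
  have hRinv : Tendsto (fun i => e i ^ (2 * w)) l (𝓝 0) := (tendsto_rpow_nhdsGT_zero hw₀).comp he
  have hg : Tendsto (fun i => 2 * δ i + K * e i ^ (2 * w)) l (𝓝 0) := by
    simpa using (hδ.const_mul 2).add (hRinv.const_mul K)
  -- Critical value in units of ε². The drift is doubled because the upper tail bound counts it
  -- twice; z = o(R) gives log α = o(R²).
  set z : ι → ℝ := fun i => 2 * (drift φ ϰ (e i) (S i) / e i ^ 2) + K with hz
  set x : ι → ℝ := fun i => (√(bigA ϰ (e i)))⁻¹ * (z i * e i ^ 2) with hxdef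
  have hfacts : ∀ᶠ i in l, 0 < e i ∧ z i * e i ^ (2 * w) ≤ 2 * δ i + K * e i ^ (2 * w) := by
    filter_upwards [hD, he.eventually self_mem_nhdsWithin] with i hDi hε
    have hε : 0 < e i := hε
    refine ⟨hε, ?_⟩
    have hR := Real.rpow_pos_of_pos hε (2 * w)
    rw [rpow_neg_two_mul hε] at hDi
    have h1 : drift φ ϰ (e i) (S i) / e i ^ 2 ≤ δ i * (e i ^ (2 * w))⁻¹ := by
      rwa [div_le_iff₀ (by positivity)]
    have h2 : drift φ ϰ (e i) (S i) / e i ^ 2 * e i ^ (2 * w) ≤ δ i := by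
      rwa [← div_eq_mul_inv, le_div_iff₀ hR] at h1
    simp only [hz]
    nlinarith
  have hz1 : ∀ i, 1 ≤ z i := fun i => by
    have : 0 ≤ drift φ ϰ (e i) (S i) / e i ^ 2 :=
      div_nonneg (drift_nonneg φ _) (sq_nonneg _)
    simp only [hz]
    linarith
  have hcrit : ∀ i, 0 < e i → √(bigA ϰ (e i)) * x i = z i * e i ^ 2 := fun i hε =>
    mul_inv_cancel_left₀ (Real.sqrt_pos.2 (hm₁.trans (hA _ hε).1)).ne' _
  have htypeI : ∀ᶠ i in l,
      Real.exp (-(16 * L ^ 2 * m₂ * z i ^ 2)) / 4 ≤ typeI P W φ ϰ (e i) (x i) := by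
    filter_upwards [hfacts, hg.eventually (gt_mem_nhds one_pos),
      he.eventually (eventually_mul_weight_le hw₁ hM (τ := 2 * L) (by linarith))]
      with i ⟨hε, hzi⟩ hgi hsmall
    have hzpos := hz1 i
    have hAi := hA _ hε
    have hzR : z i ≤ e i ^ (-2 * w) := by
      rw [rpow_neg_two_mul hε, ← one_div, le_div_iff₀ (Real.rpow_pos_of_pos hε _)]
      linarith
    have hle := le_typeI φ hW hε (hm₁.trans hAi.1) (hsum _ hε) (t := L * z i / e i ^ 2)
      (by positivity) (fun j => ?_) (x := x i) ?_
    · refine le_trans ?_ hle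
      have e1 : 16 * (L * z i / e i ^ 2) ^ 2 * (e i ^ 4 * bigA ϰ (e i)) =
        16 * L ^ 2 * bigA ϰ (e i) * z i ^ 2 := by field_simp
      rw [e1]
      gcongr
      exact hAi.2.le
    · refine le_trans ?_ ((hsmall j).trans (by norm_num))
      have : 2 * (L * z i / e i ^ 2) = 2 * L * z i / e i ^ 2 := by ring
      rw [this]
      gcongr
    · rw [hcrit i hε]
      have e1 : L * z i / e i ^ 2 * (e i ^ 4 * bigA ϰ (e i)) - Real.log 2 / (L * z i / e i ^ 2) =
          (L * bigA ϰ (e i) * z i - Real.log 2 / (L * z i)) * e i ^ 2 := by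
        field_simp
      rw [e1]
      gcongr
      have h1 : 2 * z i ≤ L * bigA ϰ (e i) * z i := by
        gcongr
        calc (2 : ℝ) = 2 / m₁ * m₁ := by field_simp
          _ ≤ L * bigA ϰ (e i) := by
            have := hAi.1.le
            gcongr
            linarith
      have h2 : Real.log 2 / (L * z i) < 1 := by
        rw [div_lt_one (by positivity)]
        nlinarith [Real.log_two_lt_d9]
      linarith
  have hpos : ∀ᶠ i in l, 0 < typeI P W φ ϰ (e i) (x i) :=
    htypeI.mono fun i hi => lt_of_lt_of_le (by positivity) hi
  have hlog : Tendsto (fun i => ((e i ^ (-2 * w)) ^ 2)⁻¹ *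
      Real.log (typeI P W φ ϰ (e i) (x i))) l (𝓝 0) := by
    have hlow : Tendsto (fun i => -(16 * L ^ 2 * m₂ * (2 * δ i + K * e i ^ (2 * w)) ^ 2 +
        Real.log 4 * (e i ^ (2 * w)) ^ 2)) l (𝓝 0) := by
      simpa using (((hg.pow 2).const_mul (16 * L ^ 2 * m₂)).add
        ((hRinv.pow 2).const_mul (Real.log 4))).neg
    refine tendsto_of_tendsto_of_tendsto_of_le_of_le' hlow tendsto_const_nhds ?_ ?_
    · filter_upwards [htypeI, hfacts] with i hi ⟨hε, hzi⟩
      have hR := Real.rpow_pos_of_pos hε (2 * w)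
      rw [rpow_neg_two_mul hε, inv_pow, inv_inv]
      have h1 := Real.log_le_log (by positivity) hi
      rw [Real.log_div (Real.exp_pos _).ne' (by norm_num), Real.log_exp] at h1
      have h2 := mul_le_mul_of_nonneg_left h1 (sq_nonneg (e i ^ (2 * w)))
      refine le_trans ?_ h2
      have h3 : (z i * e i ^ (2 * w)) ^ 2 ≤ (2 * δ i + K * e i ^ (2 * w)) ^ 2 := by
        have := hz1 i
        gcongr
      have h4 : 0 ≤ 16 * L ^ 2 * m₂ := by positivity
      nlinarith [mul_le_mul_of_nonneg_left h3 h4]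
    · filter_upwards with i
      exact mul_nonpos_of_nonneg_of_nonpos (by positivity)
        (Real.log_nonpos measureReal_nonneg measureReal_le_one)
  obtain ⟨c, hc, hβ⟩ := hcons x hpos hlog
  have hβlow : ∀ᶠ i in l, 1 - Real.exp (-1) ≤ typeII P W φ ϰ (e i) (S i) (x i) := by
    filter_upwards [hfacts, hRinv.eventually (gt_mem_nhds one_pos),
      he.eventually (eventually_mul_weight_le hw₁ hM one_pos)] with i ⟨hε, _⟩ hR1 hsmall
    have hAi := hA _ hε
    have hR := Real.rpow_pos_of_pos hε (2 * w)
    refine le_trans ?_ (le_typeII φ hW hε (hm₁.trans hAi.1) (hsum _ hε) hA1 (t := 1 / e i ^ 2)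
      (by positivity) (fun j => ?_) (S i) (x i))
    · rw [hcrit i hε]
      gcongr
      have e1 : -(1 / e i ^ 2) * (z i * e i ^ 2) + (4 * (1 / e i ^ 2) ^ 2 *
          (e i ^ 4 * bigA ϰ (e i)) + 2 * (1 / e i ^ 2) * drift φ ϰ (e i) (S i)) =
          4 * bigA ϰ (e i) - K := by
        simp only [hz]; field_simp; ring
      rw [e1]
      linarith [hAi.2]
    · refine le_trans ?_ ((hsmall j).trans (by norm_num))
      gcongr
      rw [one_mul, rpow_neg_two_mul hε]
      exact (one_le_inv₀ hR).2 hR1.le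
  have hlim : Tendsto (fun i => Real.exp (-(c * (e i ^ (-2 * w)) ^ 2))) l (𝓝 0) := by
    refine Real.tendsto_exp_neg_atTop_nhds_zero.comp ?_
    have h1 : Tendsto (fun i => e i ^ (2 * w)) l (𝓝[>] 0) :=
      tendsto_nhdsWithin_iff.2 ⟨hRinv, (he.eventually self_mem_nhdsWithin).mono fun i hi =>
        Real.rpow_pos_of_pos hi _⟩
    have h2 := tendsto_inv_nhdsGT_zero.comp h1
    refine (((tendsto_pow_atTop two_ne_zero).comp h2).const_mul_atTop hc).congr' ?_
    filter_upwards [hfacts] with i hi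
    simp only [Function.comp_apply]
    rw [rpow_neg_two_mul hi.1]
  have hlt : (0 : ℝ) < 1 - Real.exp (-1) := by
    linarith [Real.exp_lt_one_iff.2 (show (-1 : ℝ) < 0 by norm_num)]
  obtain ⟨i, h1, h2, h3⟩ := (hβ.and (hβlow.and (hlim.eventually (gt_mem_nhds hlt)))).exists
  linarith

end Consistency

/-! ### Energy of a signal in the low and in the high coordinates -/

section Energy

variable (φ : HilbertBasis ℕ+ ℝ L2)

/-- The energy of the coordinates of `S` with index in `s`. -/
def energy (s : Set ℕ+) (S : L2) : ℝ := ∑' j, s.indicator (fun j => fourier φ S j ^ 2) j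

lemma summable_energy (s : Set ℕ+) (S : L2) :
    Summable (s.indicator fun j => fourier φ S j ^ 2) :=
  (hasSum_fourier_sq φ S).summable.indicator s

lemma exists_fourier_eq_indicator (s : Set ℕ+) (S : L2) :
    ∃ S₁ : L2, ∀ j, fourier φ S₁ j = s.indicator (fourier φ S) j := by
  have hmem : Memℓp (s.indicator (fourier φ S)) 2 := by
    refine memℓp_gen ?_
    refine (summable_energy φ s S).congr fun j => ?_
    by_cases hj : j ∈ s <;> simp [hj]
  refine ⟨φ.repr.symm ⟨_, hmem⟩, fun j => ?_⟩
  rw [fourier, ← φ.repr_apply_apply, LinearIsometryEquiv.apply_symm_apply]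

variable {φ}

lemma norm_sq_of_fourier_eq_indicator {s : Set ℕ+} {S S₁ : L2}
    (h : ∀ j, fourier φ S₁ j = s.indicator (fourier φ S) j) : ‖S₁‖ ^ 2 = energy φ s S := by
  rw [← (hasSum_fourier_sq φ S₁).tsum_eq, energy]
  refine tsum_congr fun j => ?_
  rw [h j]
  by_cases hj : j ∈ s <;> simp [hj]

lemma inner_sub_of_fourier_eq_indicator {s : Set ℕ+} {S S₁ : L2}
    (h : ∀ j, fourier φ S₁ j = s.indicator (fourier φ S) j) : inner ℝ S₁ (S - S₁) = 0 := by
  refine (hasSum_fourier_mul φ S₁ (S - S₁)).unique (hasSum_zero.congr_fun fun j => ?_)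
  have : fourier φ (S - S₁) j = fourier φ S j - fourier φ S₁ j := inner_sub_right _ _ _
  rw [this, h j]
  by_cases hj : j ∈ s <;> simp [hj]

lemma energy_le_norm_sq (s : Set ℕ+) (S : L2) : energy φ s S ≤ ‖S‖ ^ 2 := by
  rw [← (hasSum_fourier_sq φ S).tsum_eq]
  exact (summable_energy φ s S).tsum_le_tsum
    (fun j => Set.indicator_le_self' (fun _ _ => sq_nonneg _) j) (hasSum_fourier_sq φ S).summable

/-- Orthogonality gives ‖S₁‖² = ∑ a_j b_j with a, b the coefficients of S₁, S. Then ab ≤ a²/4 + b²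
on s and ab ≤ M a² + b²/(4M) off s. With s a tail where S has little energy, S₁ is forced to carry
energy off s. -/
lemma norm_sq_le_energy_add {s : Set ℕ+} {S S₁ : L2} (h : inner ℝ S₁ (S - S₁) = 0) {M : ℝ}
    (hM : 0 < M) :
    ‖S₁‖ ^ 2 ≤ ‖S₁‖ ^ 2 / 4 + energy φ s S + M * energy φ sᶜ S₁ + ‖S‖ ^ 2 / (4 * M) := by
  have hin : inner ℝ S₁ S = ‖S₁‖ ^ 2 := by
    rw [inner_sub_right, real_inner_self_eq_norm_sq] at h
    linarith
  have h1 := hasSum_fourier_mul φ S₁ S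
  rw [hin] at h1
  have h2 := ((((hasSum_fourier_sq φ S₁).div_const 4).add (summable_energy φ s S).hasSum).add
    ((summable_energy φ sᶜ S₁).hasSum.mul_left M)).add
    ((hasSum_fourier_sq φ S).div_const (4 * M))
  refine hasSum_le (fun j => ?_) h1 h2
  set a := fourier φ S₁ j
  set b := fourier φ S j
  by_cases hj : j ∈ s
  · have h3 : 0 ≤ b ^ 2 / (4 * M) := by positivity
    simp only [hj, Set.indicator_of_mem, Set.mem_compl_iff, not_true_eq_false,
      not_false_eq_true, Set.indicator_of_notMem]
    nlinarith [sq_nonneg (a / 2 - b)]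
  · have h3 : b ^ 2 / (4 * M) - a * b + M * a ^ 2 = (b - 2 * M * a) ^ 2 / (4 * M) := by
      field_simp; ring
    have h4 : 0 ≤ (b - 2 * M * a) ^ 2 / (4 * M) := by positivity
    simp only [hj, Set.indicator_of_mem, Set.mem_compl_iff, not_false_eq_true,
      Set.indicator_of_notMem]
    nlinarith [sq_nonneg a]

variable {ϰ : ℝ → ℕ → ℝ} {ε c : ℝ}

lemma mul_energy_le_drift (hA1 : A1 ϰ) (hε : 0 < ε) (S : L2) :
    ϰ ε ⌊c⌋₊ ^ 2 / ε ^ 2 * energy φ {j : ℕ+ | c < (j : ℕ)}ᶜ S ≤ drift φ ϰ ε S := by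
  rw [energy, ← tsum_mul_left, drift]
  refine ((summable_energy φ _ S).mul_left _).tsum_le_tsum (fun j => ?_)
    (summable_weight_mul_sq φ hA1 hε S)
  by_cases hj : c < (j : ℕ)
  · simp only [Set.mem_compl_iff, Set.mem_ofPred_eq, hj, not_true_eq_false, not_false_eq_true,
      Set.indicator_of_notMem, mul_zero]
    positivity
  · simp only [Set.mem_compl_iff, Set.mem_ofPred_eq, hj, not_false_eq_true,
      Set.indicator_of_mem]
    have hle : (j : ℕ) ≤ ⌊c⌋₊ := Nat.le_floor (not_lt.1 hj)
    have := hA1 ε hε (Set.mem_Ici.2 j.pos) (Set.mem_Ici.2 (j.pos.trans_le hle)) hle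
    calc ϰ ε ⌊c⌋₊ ^ 2 / ε ^ 2 * fourier φ S j ^ 2
        = ϰ ε ⌊c⌋₊ ^ 2 * (fourier φ S j / ε) ^ 2 := by ring
      _ ≤ _ := mul_le_mul_of_nonneg_right this (sq_nonneg _)

lemma drift_le_mul_norm_sq (hA1 : A1 ϰ) (hε : 0 < ε) (hc : 1 ≤ c) {S : L2}
    (h : ∀ j : ℕ+, ¬ c < (j : ℕ) → fourier φ S j = 0) :
    drift φ ϰ ε S ≤ ϰ ε ⌊c⌋₊ ^ 2 / ε ^ 2 * ‖S‖ ^ 2 := by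
  have hs := (hasSum_fourier_sq φ S).mul_left (ϰ ε ⌊c⌋₊ ^ 2 / ε ^ 2)
  rw [← hs.tsum_eq, drift]
  refine (summable_weight_mul_sq φ hA1 hε S).tsum_le_tsum (fun j => ?_) hs.summable
  by_cases hj : c < (j : ℕ)
  · have hle : ⌊c⌋₊ ≤ (j : ℕ) := Nat.floor_le_of_le hj.le
    -- c ≥ 1 keeps the floor away from index 0, about which A1 says nothing.
    have := hA1 ε hε (Set.mem_Ici.2 (Nat.le_floor (by simpa using hc)))
      (Set.mem_Ici.2 j.pos) hle
    calc ϰ ε j ^ 2 * (fourier φ S j / ε) ^ 2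
        ≤ ϰ ε ⌊c⌋₊ ^ 2 * (fourier φ S j / ε) ^ 2 :=
          mul_le_mul_of_nonneg_right this (sq_nonneg _)
      _ = _ := by ring
  · simp [h j hj]

lemma tsum_subtype_eq_energy (s : Set ℕ+) (S : L2) :
    ∑' j : s, |fourier φ S j| ^ 2 = energy φ s S := by
  simp only [sq_abs]
  exact tsum_subtype s fun j => fourier φ S j ^ 2

end Energy

/-! ### Tail energy versus consistency of orthogonal parts -/

lemma rpow_two_mul_sq {ε : ℝ} (hε : 0 < ε) (r : ℝ) : (ε ^ (2 * r)) ^ 2 = ε ^ (4 * r) := by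
  rw [← Real.rpow_natCast, ← Real.rpow_mul hε.le]
  congr 1; push_cast; ring

/-- The balance of exponents: energy ε^{4r} at weight of order ϰ_ε² yields exactly the critical
drift order. -/
lemma rpow_mul_rpow_div_sq {ε : ℝ} (hε : 0 < ε) (r w : ℝ) :
    ε ^ (4 - 4 * r - 2 * w) * ε ^ (4 * r) / ε ^ 2 = ε ^ (-2 * w) * ε ^ 2 := by
  rw [← Real.rpow_two, ← Real.rpow_add hε, ← Real.rpow_sub hε, ← Real.rpow_add hε]
  congr 1; ring

section Main

variable {Ω : Type*} [MeasurableSpace Ω] {P : Measure Ω} [IsProbabilityMeasure P]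
  {W : L2 → Ω → ℝ} (hW : IsWhiteNoise P W) {φ : HilbertBasis ℕ+ ℝ L2}
  {r w : ℝ} (hw₀ : 0 < 2 * w) (hw₁ : 2 * w < 1 - 2 * r) {ϰ : ℝ → ℕ → ℝ}
  (hsum : ∀ ε > 0, Summable fun j : ℕ+ => ϰ ε j ^ 2)
  (hA1 : A1 ϰ) (hA2 : A2 ϰ) (hA3 : A3 ϰ) (hA4 : A4 ϰ)
  (hk : (fun ε => (kIdx ϰ ε : ℝ)) =Θ[𝓝[>] (0 : ℝ)] fun ε => ε ^ (-4 + 8 * r + 4 * w))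
  {S : ℝ → L2} (hS : (fun ε => ‖S ε‖) =Θ[𝓝[>] (0 : ℝ)] fun ε => ε ^ (2 * r))

include hS in
lemma eventually_norm_sq_le : ∃ B > 0, ∀ᶠ ε in 𝓝[>] (0 : ℝ), ‖S ε‖ ^ 2 ≤ B * ε ^ (4 * r) := by
  obtain ⟨B, hB, h⟩ := hS.1.exists_pos
  refine ⟨B ^ 2, by positivity, ?_⟩
  filter_upwards [h.bound, self_mem_nhdsWithin] with ε hε hpos
  rw [← rpow_two_mul_sq hpos, ← mul_pow]
  rw [norm_norm, Real.norm_of_nonneg (Real.rpow_nonneg (le_of_lt hpos) _)] at hε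
  exact pow_le_pow_left₀ (norm_nonneg _) hε 2

include hW hw₁ hsum hA1 hA2 hA3 hA4 hk hS

/-- If the tails of `S_ε` beyond multiples of `k_ε` are negligible, then all parts of `S_ε` of
order `ε^{2r}` that are orthogonal to their complement are consistent. -/
lemma ldConsistent_of_energy_le
    (htail : ∀ δ > (0 : ℝ), ∃ C₁ > (0 : ℝ), ∀ᶠ ε in 𝓝[>] (0 : ℝ),
      energy φ {j : ℕ+ | C₁ * (kIdx ϰ ε : ℝ) < (j : ℕ)} (S ε) ≤ δ * ε ^ (4 * r))
    {ι : Type*} {l : Filter ι} {e : ι → ℝ} (he : Tendsto e l (𝓝[>] 0)) {S₁ : ι → L2}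
    {c₁ : ℝ} (hc₁ : 0 < c₁) (hnorm : ∀ᶠ i in l, c₁ * e i ^ (2 * r) ≤ ‖S₁ i‖)
    (horth : ∀ i, inner ℝ (S₁ i) (S (e i) - S₁ i) = 0) :
    LDConsistent P W φ ϰ l e (fun i => e i ^ (-2 * w)) S₁ := by
  obtain ⟨a, ha, C₀, hC₀, hκ⟩ := kappaSq_bounds hA1 hA2 hA3 hA4 hk
  obtain ⟨B, hB, hSB⟩ := eventually_norm_sq_le hS
  obtain ⟨C₁, hC₁, htail⟩ := htail (c₁ ^ 2 / 4) (by positivity)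
  -- A4 requires a factor above 1; enlarging the cutoff only shrinks the tail.
  set c := max C₁ 2 with hc
  obtain ⟨b, hb, hA4c⟩ := hA4.2 c (by rw [hc]; exact lt_max_of_lt_right one_lt_two)
  -- Then the tail of S and the term ‖S‖²/(4M) are each at most c₁²ε^{4r}/4, which leaves at least
  -- c₁²ε^{4r}/4 for M times the head energy of S₁.
  set M := B / c₁ ^ 2 with hMdef
  have hMpos : 0 < M := by positivity
  refine ldConsistent_of_le_drift hW φ hw₁ hsum hA1 hA2 (hκ.mono fun ε h => h.2.2.2) he
    (c := b * a * (c₁ ^ 2 / (4 * M))) (by positivity) ?_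
  filter_upwards [hnorm, he.eventually hκ, he.eventually hSB, he.eventually htail,
    he.eventually self_mem_nhdsWithin] with i hn hκi hSi hti hε
  have hε : 0 < e i := hε
  set ε := e i with hεdef
  set E := ε ^ (4 * r) with hE
  have hEpos : 0 < E := Real.rpow_pos_of_pos hε _
  set s := {j : ℕ+ | c * (kIdx ϰ ε : ℝ) < (j : ℕ)} with hs
  have hts : energy φ s (S ε) ≤ c₁ ^ 2 / 4 * E := by
    refine le_trans ?_ hti
    refine (summable_energy φ _ _).tsum_le_tsum (fun j => ?_) (summable_energy φ _ _)
    refine Set.indicator_le_indicator_of_subset (fun j hj => ?_) (fun _ => sq_nonneg _) j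
    refine lt_of_le_of_lt ?_ (show c * (kIdx ϰ ε : ℝ) < (j : ℕ) from hj)
    gcongr
    exact le_max_left _ _
  have hn2 : c₁ ^ 2 * E ≤ ‖S₁ i‖ ^ 2 := by
    rw [hE, ← rpow_two_mul_sq hε, ← mul_pow]
    have := Real.rpow_pos_of_pos hε (2 * r)
    exact pow_le_pow_left₀ (by positivity) hn 2
  have hmain := norm_sq_le_energy_add (φ := φ) (s := s) (horth i) hMpos
  have h4 : ‖S ε‖ ^ 2 / (4 * M) ≤ c₁ ^ 2 / 4 * E := by
    rw [div_le_iff₀ (by positivity)]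
    refine hSi.trans_eq ?_
    rw [hMdef]; field_simp
  have hhead : c₁ ^ 2 / (4 * M) * E ≤ energy φ sᶜ (S₁ i) := by
    rw [div_mul_eq_mul_div, div_le_iff₀ (by positivity)]
    linarith
  refine le_trans ?_ (mul_energy_le_drift (c := c * kIdx ϰ ε) hA1 hε (S₁ i))
  calc b * a * (c₁ ^ 2 / (4 * M)) * ε ^ (-2 * w) * ε ^ 2
      = b * (a * ε ^ (4 - 4 * r - 2 * w)) / ε ^ 2 * (c₁ ^ 2 / (4 * M) * E) := by
        rw [mul_assoc _ (ε ^ (-2 * w)), ← rpow_mul_rpow_div_sq hε r w]; ring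
    _ ≤ ϰ ε ⌊c * (kIdx ϰ ε : ℝ)⌋₊ ^ 2 / ε ^ 2 * energy φ sᶜ (S₁ i) := by
        gcongr
        exact (mul_le_mul_of_nonneg_left hκi.2.1 hb.le).trans (hA4c ε hε)

include hw₀ in
/-- If the tails of `S_ε` beyond multiples of `k_ε` are not negligible, then suitable tails of
`S_ε` form an inconsistent sequence. -/
lemma exists_inconsistent_of_energy_gt {δ : ℝ} (hδ : 0 < δ)
    (htail : ∀ C₁ > (0 : ℝ), ∀ ε₀ > (0 : ℝ), ∃ ε, 0 < ε ∧ ε < ε₀ ∧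
      δ * ε ^ (4 * r) < energy φ {j : ℕ+ | C₁ * (kIdx ϰ ε : ℝ) < (j : ℕ)} (S ε)) :
    ∃ (e : ℕ → ℝ) (S₁ : ℕ → L2),
      (∀ i, 0 < e i) ∧ Tendsto e atTop (𝓝 0) ∧
      (∃ c₁ > 0, ∀ i, c₁ * e i ^ (2 * r) < ‖S₁ i‖) ∧
      (∀ i, inner ℝ (S₁ i) (S (e i) - S₁ i) = 0) ∧
      ¬ LDConsistent P W φ ϰ atTop e (fun i => e i ^ (-2 * w)) S₁ := by
  obtain ⟨a, ha, C₀, hC₀, hκ⟩ := kappaSq_bounds hA1 hA2 hA3 hA4 hk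
  obtain ⟨B, hB, hSB⟩ := eventually_norm_sq_le hS
  obtain ⟨D, hD, lam, hlam, hA3'⟩ := hA3
  -- Cutoff factors grow while noise levels vanish; i + 2 = 1 + δ with δ = i + 1 fits A3, whose
  -- factor (i+2)^{-lam} tends to 0.
  choose e hepos hlt hgt using fun i : ℕ =>
    htail ((i : ℝ) + 2) (by positivity) (1 / ((i : ℝ) + 1)) (by positivity)
  choose S₁ hS₁ using fun i : ℕ => exists_fourier_eq_indicator φ
    {j : ℕ+ | ((i : ℝ) + 2) * (kIdx ϰ (e i) : ℝ) < (j : ℕ)} (S (e i))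
  have he0 : Tendsto e atTop (𝓝 0) :=
    squeeze_zero (fun i => (hepos i).le) (fun i => (hlt i).le)
      tendsto_one_div_add_atTop_nhds_zero_nat
  have he : Tendsto e atTop (𝓝[>] 0) :=
    tendsto_nhdsWithin_iff.2 ⟨he0, Eventually.of_forall hepos⟩
  refine ⟨e, S₁, hepos, he0, ⟨√δ, by positivity, fun i => ?_⟩,
    fun i => inner_sub_of_fourier_eq_indicator (hS₁ i), ?_⟩
  · refine lt_of_pow_lt_pow_left₀ 2 (norm_nonneg _) ?_
    rw [mul_pow, Real.sq_sqrt hδ.le, rpow_two_mul_sq (hepos i),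
      norm_sq_of_fourier_eq_indicator (hS₁ i)]
    exact hgt i
  · have hlim : Tendsto (fun i : ℕ => D * C₀ * B * ((i : ℝ) + 2) ^ (-lam)) atTop (𝓝 0) := by
      have h := (tendsto_rpow_neg_atTop (zero_lt_one.trans hlam)).comp
        (tendsto_atTop_add_const_right atTop (2 : ℝ) tendsto_natCast_atTop_atTop)
      simpa using h.const_mul (D * C₀ * B)
    refine not_ldConsistent_of_drift_le hW φ hw₀ hw₁ hsum hA1 hA2
      (hκ.mono fun ε h => h.2.2.2) he hlim ?_
    filter_upwards [he.eventually hκ, he.eventually hSB] with i hκi hSi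
    have hε := hepos i
    have hk1 : (1 : ℝ) ≤ kIdx ϰ (e i) := by exact_mod_cast hκi.1
    have hi2 : (1 : ℝ) ≤ (i : ℝ) + 2 := by linarith [(Nat.cast_nonneg i : (0 : ℝ) ≤ i)]
    have hd := drift_le_mul_norm_sq (φ := φ) (c := ((i : ℝ) + 2) * kIdx ϰ (e i)) hA1 hε
      (by nlinarith) (S := S₁ i) fun j hj => by rw [hS₁ i j]; simp [hj]
    have hnorm : ‖S₁ i‖ ^ 2 ≤ B * e i ^ (4 * r) := by
      rw [norm_sq_of_fourier_eq_indicator (hS₁ i)]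
      exact (energy_le_norm_sq _ _).trans hSi
    have h3 := hA3' ((i : ℝ) + 1) (by positivity) (e i) hε
    rw [show 1 + ((i : ℝ) + 1) = i + 2 by ring] at h3
    have h4 : ϰ (e i) ⌊((i : ℝ) + 2) * (kIdx ϰ (e i) : ℝ)⌋₊ ^ 2 ≤
        D * ((i : ℝ) + 2) ^ (-lam) * (C₀ * e i ^ (4 - 4 * r - 2 * w)) := by
      refine h3.le.trans ?_
      gcongr
      exact hκi.2.2.1
    calc drift φ ϰ (e i) (S₁ i) ≤ _ := hd
      _ ≤ D * ((i : ℝ) + 2) ^ (-lam) * (C₀ * e i ^ (4 - 4 * r - 2 * w)) / e i ^ 2 *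
          (B * e i ^ (4 * r)) := by gcongr
      _ = D * C₀ * B * ((i : ℝ) + 2) ^ (-lam) *
          (e i ^ (4 - 4 * r - 2 * w) * e i ^ (4 * r) / e i ^ 2) := by ring
      _ = _ := by rw [rpow_mul_rpow_div_sq hε]; ring

end Main

end SignalDetection

end

theorem mainTheorem4
    {Ω : Type*} [MeasurableSpace Ω] (P : Measure Ω) [IsProbabilityMeasure P]
    (W : SignalDetection.L2 → Ω → ℝ) (hW : SignalDetection.IsWhiteNoise P W)
    (φ : HilbertBasis ℕ+ ℝ SignalDetection.L2)
    (r w : ℝ) (hr₀ : 0 < r) (hr₁ : r < 1 / 2) (hw₀ : 0 < 2 * w) (hw₁ : 2 * w < 1 - 2 * r)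
    (ϰ : ℝ → ℕ → ℝ)
    (hsum : ∀ ε > 0, Summable fun j : ℕ+ => ϰ ε j ^ 2)
    (hA1 : SignalDetection.A1 ϰ) (hA2 : SignalDetection.A2 ϰ)
    (hA3 : SignalDetection.A3 ϰ) (hA4 : SignalDetection.A4 ϰ)
    (hk : (fun ε => (SignalDetection.kIdx ϰ ε : ℝ)) =Θ[𝓝[>] (0 : ℝ)]
      fun ε => ε ^ (-4 + 8 * r + 4 * w))
    (S : ℝ → SignalDetection.L2)
    (hS : (fun ε => ‖S ε‖) =Θ[𝓝[>] (0 : ℝ)] fun ε => ε ^ (2 * r)) :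
    SignalDetection.PurelyLDConsistent P W φ ϰ r w S ↔
      ∀ δ > (0 : ℝ), ∃ C₁ > (0 : ℝ), ∃ ε₀ > (0 : ℝ), ∀ ε : ℝ, 0 < ε → ε < ε₀ →
        ∑' j : {j : ℕ+ // C₁ * (SignalDetection.kIdx ϰ ε : ℝ) < (j : ℕ)},
          |SignalDetection.fourier φ (S ε) j| ^ 2 ≤ δ * ε ^ (4 * r) := by
  have hen : ∀ C₁ ε, ∑' j : {j : ℕ+ // C₁ * (SignalDetection.kIdx ϰ ε : ℝ) < (j : ℕ)},
      |SignalDetection.fourier φ (S ε) j| ^ 2 =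
      SignalDetection.energy φ {j : ℕ+ | C₁ * (SignalDetection.kIdx ϰ ε : ℝ) < (j : ℕ)} (S ε) :=
    fun C₁ ε => SignalDetection.tsum_subtype_eq_energy
      {j : ℕ+ | C₁ * (SignalDetection.kIdx ϰ ε : ℝ) < (j : ℕ)} (S ε)
  simp only [hen]
  constructor
  · rintro ⟨-, hpure⟩
    by_contra! hcon
    obtain ⟨δ, hδ, htail⟩ := hcon
    exact hpure (SignalDetection.exists_inconsistent_of_energy_gt hW hw₀ hw₁ hsum hA1 hA2 hA3 hA4
      hk hS hδ htail)
  · intro htail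
    have htail' : ∀ δ > (0 : ℝ), ∃ C₁ > (0 : ℝ), ∀ᶠ ε in 𝓝[>] (0 : ℝ),
        SignalDetection.energy φ {j : ℕ+ | C₁ * (SignalDetection.kIdx ϰ ε : ℝ) < (j : ℕ)} (S ε) ≤
          δ * ε ^ (4 * r) := fun δ hδ => by
      obtain ⟨C₁, hC₁, ε₀, hε₀, h⟩ := htail δ hδ
      refine ⟨C₁, hC₁, ?_⟩
      filter_upwards [Ioo_mem_nhdsGT hε₀] with ε hε using h ε hε.1 hε.2
    refine ⟨?_, ?_⟩
    -- S_ε itself is an orthogonal part, with zero complement.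
    · obtain ⟨c, hc, h⟩ := hS.2.exists_pos
      refine SignalDetection.ldConsistent_of_energy_le hW hw₁ hsum hA1 hA2 hA3 hA4 hk hS htail'
        tendsto_id (inv_pos.2 hc) ?_ (fun ε => by simp)
      filter_upwards [h.bound, self_mem_nhdsWithin] with ε hε hpos
      rw [norm_norm, Real.norm_of_nonneg (Real.rpow_nonneg (le_of_lt hpos) _)] at hε
      rw [id_eq, inv_mul_le_iff₀ hc]
      exact hε
    · rintro ⟨e, S₁, hepos, he0, ⟨c₁, hc₁, hnorm⟩, horth, hnot⟩
      exact hnot (SignalDetection.ldConsistent_of_energy_le hW hw₁ hsum hA1 hA2 hA3 hA4 hk hS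
        htail' (tendsto_nhdsWithin_iff.2 ⟨he0, Eventually.of_forall hepos⟩) hc₁
        (Eventually.of_forall fun i => (hnorm i).le) horth)
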